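/- \textbf{Definitions.} A profile $P=(P_1,\dots,P_n)$ consists of strict linear orders of $n$ voters $V=\{1,\dots,n\}$ over a finite nonempty set $A=\{a_1,\dots,a_m\}$ of alternatives; write $a\succ_v b$ if voter $v$ prefers $a$ to $b$, and let $\mathrm{pos}_v(a)$ be the position of $a$ in the order of $v$. The profile is \emph{single-crossing with respect to a tree} $T$ with vertex set $V$ if, for all voters $i,j,k$ such that $j$ lies on the path of $T$ from $i$ to $k$, and all $a,b\in A$, $a\succ_i b$ and $a\succ_k b$ imply $a\succ_j b$. A map $\rho\colon V\times A\to\mathbb{Q}_{\ge 0}$ is a \emph{misrepresentation function} for $P$ if $\mathrm{pos}_v(c)<\mathrm{pos}_v(c')$ implies $\rho(v,c)\le\rho(v,c')$. A \emph{$k$-assignment} is a map $w\colon V\to A$ with $|w(V)|\le k$. Its total misrepresentation is $\sum_{v\in V}\rho(v,w(v))$ in the utilitarian version, and $\max_{v\in V}\rho(v,w(v))$ in the egalitarian version, of the Chamberlin--Courant rule; $w$ is \emph{optimal} if it minimizes this total among all $k$-assignments. \textbf{Theorem.} Let $r$ be a function that assigns to every profile $P$ (with any numbers of voters and alternatives),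 every finite datum $x$ (additional information that may accompany the profile, such as approval ballots, and that $r$ may ignore), every voter $v$ and every alternative $c$ a number $r_{P,x}(v,c)\in\mathbb{Q}_{\ge 0}$, and suppose that $r$ is computable in polynomial time in the size of $(P,x,v,c)$, with rational numbers written in binary. Then for each of the two versions, utilitarian and egalitarian, of the Chamberlin--Courant rule there is an algorithm which, given a profile $P$ that is single-crossing with respect to some tree (the tree is not given), a datum $x$ for which $r_{P,x}$ is a misrepresentation function for $P$, and a positive integer $k$ written in binary, finds an optimal $k$-assignment for $P$ with respect to $r_{P,x}$ in time polynomial in the size of the input $(P,x,k)$. -/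

import Mathlib

namespace CC

/-! ## Model of computation

A `while`-language over binary trees.  Every operation is charged at least the size of the datum
it works on, so the cost of a run bounds both the number of operations and the size of every
intermediate value; polynomial cost is therefore the same as polynomial time on a Turing machine. -/

/-- Binary trees, the data on which programs operate. -/
inductive Data : Type
  | nil : Data
  | cons : Data → Data → Data

namespace Data

/-- The number of nodes (leaves included). -/
def size : Data → ℕ
  | nil => 1
  | cons a b => a.size + b.size + 1

/-- The first component (`nil` if there is none). -/
def fst : Data → Data
  | nil => nil
  | cons a _ => a

/-- The second component (`nil` if there is none). -/
def snd : Data → Data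
  | nil => nil
  | cons _ b => b

/-- Finite lists, as right combs that end in `nil`. -/
def ofList : List Data → Data
  | [] => nil
  | a :: l => cons a (ofList l)

def ofBool : Bool → Data
  | false => nil
  | true => cons nil nil

/-- Natural numbers in binary, as lists of bits. -/
def ofNat (n : ℕ) : Data := ofList (n.bits.map ofBool)

/-- Nonnegative rationals, as numerator and denominator in lowest terms, in binary. -/
def ofRat (q : ℚ≥0) : Data := cons (ofNat q.num) (ofNat q.den)

end Data

/-- Programs.  Each program denotes a partial function from trees to trees. -/
inductive Prog : Type
  /-- return the input -/
  | id : Prog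
  /-- return `nil` -/
  | nil : Prog
  /-- return the first component of the input -/
  | fst : Prog
  /-- return the second component of the input -/
  | snd : Prog
  /-- run two programs on the input and pair their results -/
  | cons : Prog → Prog → Prog
  /-- `seq p q`: run `p`, then run `q` on the result of `p` -/
  | seq : Prog → Prog → Prog
  /-- `cond c p q`: run `c` on the input; continue with `p` on the input if the result is not
  `nil`, with `q` on the input otherwise -/
  | cond : Prog → Prog → Prog → Prog
  /-- `loop c p`: as long as the result of `c` on the current value is not `nil`, replace the
  current value by the result of `p` on it; return the current value in the end -/
  | loop : Prog → Prog → Prog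

/-- `Runs p x y t`: started on `x`, the program `p` halts with result `y` after a run of
cost `t`. -/
inductive Runs : Prog → Data → Data → ℕ → Prop
  | id (x : Data) : Runs .id x x x.size
  | nil (x : Data) : Runs .nil x .nil x.size
  | fst (x : Data) : Runs .fst x x.fst x.size
  | snd (x : Data) : Runs .snd x x.snd x.size
  | cons {p q : Prog} {x a b : Data} {s t : ℕ} :
      Runs p x a s → Runs q x b t → Runs (.cons p q) x (.cons a b) (x.size + s + t)
  | seq {p q : Prog} {x y z : Data} {s t : ℕ} :
      Runs p x y s → Runs q y z t → Runs (.seq p q) x z (s + t)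
  | cond_true {c p q : Prog} {x b y : Data} {s t : ℕ} :
      Runs c x b s → b ≠ .nil → Runs p x y t → Runs (.cond c p q) x y (x.size + s + t)
  | cond_false {c p q : Prog} {x y : Data} {s t : ℕ} :
      Runs c x .nil s → Runs q x y t → Runs (.cond c p q) x y (x.size + s + t)
  | loop_true {c p : Prog} {x b y z : Data} {s t u : ℕ} :
      Runs c x b s → b ≠ .nil → Runs p x y t → Runs (.loop c p) y z u →
        Runs (.loop c p) x z (x.size + s + t + u)
  | loop_false {c p : Prog} {x : Data} {s : ℕ} :
      Runs c x .nil s → Runs (.loop c p) x x (x.size + s)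

/-- A family of instances `i : ι`, presented to the program as `input i`, is solvable in polynomial
time if a single program halts on every valid instance, with a correct answer, at a cost bounded
by a polynomial in the size of the input. -/
def PolyTimeSolvable {ι : Type} (input : ι → Data) (Valid : ι → Prop)
    (IsAnswer : ι → Data → Prop) : Prop :=
  ∃ (p : Prog) (bound : Polynomial ℕ), ∀ i : ι, Valid i →
    ∃ (y : Data) (t : ℕ), Runs p (input i) y t ∧ t ≤ bound.eval (input i).size ∧ IsAnswer i y

/-! ## Profiles -/

/-- A profile of `n` voters over `m` alternatives.  The strict linear order of voter `v` is given
as a ranking: `rank v j` is the alternative in position `j`, position `0` being the best. -/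
structure Profile where
  n : ℕ
  m : ℕ
  rank : Fin n → Equiv.Perm (Fin m)

namespace Profile

variable (P : Profile)

/-- The position of alternative `a` in the ranking of voter `v` (the best one has position 0). -/
def pos (v : Fin P.n) (a : Fin P.m) : Fin P.m := (P.rank v).symm a

/-- Voter `v` prefers `a` to `b`. -/
def Prefers (v : Fin P.n) (a b : Fin P.m) : Prop := P.pos v a < P.pos v b

/-- The order of voter `j` is between those of voters `i` and `k`. -/
def Between (i j k : Fin P.n) : Prop :=
  ∀ a b : Fin P.m, P.Prefers i a b → P.Prefers k a b → P.Prefers j a b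

/-- The profile is intermediate on the graph `G` on the voters: the order of `j` is between those
of `i` and `k` whenever `j` lies on a shortest path from `i` to `k`. -/
def IntermediateOn (G : SimpleGraph (Fin P.n)) : Prop :=
  ∀ i j k : Fin P.n, G.dist i k = G.dist i j + G.dist j k → P.Between i j k

/-- The profile is single-crossing with respect to some tree whose vertices are the voters. -/
def SingleCrossingOnTree : Prop :=
  ∃ T : SimpleGraph (Fin P.n), T.IsTree ∧ P.IntermediateOn T

/-- `ρ v c` is the misrepresentation of voter `v` when represented by `c`: it does not decrease
when `c` moves down in the ranking of `v`. -/
def IsMisrepresentation (ρ : Fin P.n → Fin P.m → ℚ≥0) : Prop :=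
  ∀ (v : Fin P.n) (c c' : Fin P.m), P.pos v c < P.pos v c' → ρ v c ≤ ρ v c'

/-- The list of the rankings of the voters, each a list of alternatives from best to worst. -/
def encode : Data :=
  Data.ofList (List.ofFn fun v : Fin P.n =>
    Data.ofList (List.ofFn fun j : Fin P.m => Data.ofNat (P.rank v j)))

end Profile

/-! ## The Chamberlin–Courant rule -/

/-- The two versions of the rule. -/
inductive Version : Type
  | utilitarian : Version
  | egalitarian : Version

/-- Total misrepresentation of the assignment `w`: the sum or the maximum over all voters. -/
def total {n m : ℕ} (ver : Version) (ρ : Fin n → Fin m → ℚ≥0) (w : Fin n → Fin m) : ℚ≥0 :=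
  match ver with
  | .utilitarian => ∑ v, ρ v (w v)
  | .egalitarian => Finset.univ.sup fun v => ρ v (w v)

/-- At most `k` alternatives represent voters. -/
def IsKAssignment {n m : ℕ} (k : ℕ) (w : Fin n → Fin m) : Prop :=
  (Finset.univ.image w).card ≤ k

/-- `w` is a `k`-assignment of least total misrepresentation. -/
def IsOptimal {n m : ℕ} (ver : Version) (ρ : Fin n → Fin m → ℚ≥0) (k : ℕ)
    (w : Fin n → Fin m) : Prop :=
  IsKAssignment k w ∧
    ∀ w' : Fin n → Fin m, IsKAssignment k w' → total ver ρ w ≤ total ver ρ w'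

/-- An assignment, as the list of the representatives of voters `0, 1, …, n - 1`. -/
def encodeAssignment {n m : ℕ} (w : Fin n → Fin m) : Data :=
  Data.ofList (List.ofFn fun v => Data.ofNat (w v))

/-- A function that attaches to every profile `P`, for any numbers of voters and alternatives, the
numbers `r P x v c` from which the misrepresentation is read off.  The argument `x` is information
that may come with the profile (approval ballots, say); it may be ignored. -/
abbrev MisrepresentationFunction : Type :=
  (P : Profile) → Data → Fin P.n → Fin P.m → ℚ≥0

/-- The arguments of a misrepresentation function. -/
structure Query where
  P : Profile
  x : Data
  v : Fin P.n
  c : Fin P.m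

def Query.encode (q : Query) : Data :=
  .cons q.P.encode (.cons q.x (.cons (Data.ofNat q.v) (Data.ofNat q.c)))

/-- `r` is computable in polynomial time, uniformly in its arguments. -/
def PolyTimeComputable (r : MisrepresentationFunction) : Prop :=
  PolyTimeSolvable Query.encode (fun _ => True)
    fun q y => y = Data.ofRat (r q.P q.x q.v q.c)

/-- An input of the winner determination problem: a profile, the information that comes with it,
and the number `k` of representatives. -/
structure Instance where
  P : Profile
  x : Data
  k : ℕ

def Instance.encode (I : Instance) : Data :=
  .cons I.P.encode (.cons I.x (Data.ofNat I.k))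

end CC

/-! The tree is never reconstructed. Call `p` a gate for `v` in a set `S` of voters if the order of
`p` lies between that of `v` and that of every other member of `S`. As long as at least two voters
are left, the algorithm looks for a pair consisting of a voter and a gate for it by testing all
pairs, attaches the voter to its gate and deletes it. The deletions build a tree of their own, which
serves in place of the unknown one.

A gate always exists. The set of orders occurring in `S` is kept closed under paths of the unknown
tree `T` (`TreeClosed`). If two members share an order, each is a gate for the other. Otherwise root
`T` at a member of `S`, take for each order in `S` its occurrences nearest to the root, and among
these a farthest vertex; its neighbour towards the root has an order occurring in `S`, and this
order separates it from all others (`TreeClosed.exists_isGate`). Deleting `v` preserves closedness,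
because an order lying between two remaining ones and equal to that of `v` is also the order of the
gate (`same_of_between`, `TreeClosed.erase`).

Giving every voter the favourite among the chosen alternatives does not increase the cost, and then
the voters sharing a representative form a convex set (`exists_convexAssignment`). For such an
assignment, if a deleted voter `v` and its gate have different representatives, that of `v`
represents nobody among the remaining voters. So the number of cuts, that is of attachments with
different labels, is at most the number of alternatives used minus one; conversely, any assignment
with `j` cuts uses at most `j + 1` alternatives. A dynamic program that keeps, for each remaining
voter, label and number of cuts, one cheapest partial assignment therefore finds an optimum
(`DPInv`, `dpResult_spec`).

For the running time, `PolyTime E F` states that one program computes `F i` from `E i` for all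
indices `i`. Local variables of loops are added to the index type and to the environment `E`, and
subtypes of indices record what is known inside a branch or a loop, so programs arise by combining
closure lemmas. Iteration additionally needs a polynomial bound on all intermediate values. For the
dynamic program it comes from the invariant: tables have at most `m * n` entries, and fractions,
which are never reduced, have bit lengths that only add up when subtrees are joined (`fracOp_le`,
`size_stateData_le`). -/

namespace CC

/-! ## Polynomial bounds -/

/-- `f` is bounded by a polynomial in `g`. -/
def PolyBound {ι : Type} (f g : ι → ℕ) : Prop :=
  ∃ q : Polynomial ℕ, ∀ i, f i ≤ q.eval (g i)

theorem polynomial_eval_mono (q : Polynomial ℕ) {a b : ℕ} (h : a ≤ b) : q.eval a ≤ q.eval b := by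
  rw [Polynomial.eval_eq_sum_range, Polynomial.eval_eq_sum_range]
  gcongr

namespace PolyBound

variable {ι κ : Type} {f f' g g' h : ι → ℕ}

theorem refl (f : ι → ℕ) : PolyBound f f := ⟨Polynomial.X, fun i => by simp⟩

theorem const (c : ℕ) (g : ι → ℕ) : PolyBound (fun _ => c) g :=
  ⟨Polynomial.C c, fun i => by simp⟩

theorem trans (h₁ : PolyBound f g) (h₂ : PolyBound g h) : PolyBound f h := by
  obtain ⟨q, hq⟩ := h₁
  obtain ⟨r, hr⟩ := h₂
  refine ⟨q.comp r, fun i => ?_⟩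
  rw [Polynomial.eval_comp]
  exact (hq i).trans (polynomial_eval_mono q (hr i))

theorem of_le (h : ∀ i, f i ≤ g i) : PolyBound f g := ⟨Polynomial.X, fun i => by simpa using h i⟩

theorem mono_left (h : ∀ i, f i ≤ f' i) (h' : PolyBound f' g) : PolyBound f g :=
  (of_le h).trans h'

theorem mono_right (h' : PolyBound f g) (h : ∀ i, g i ≤ g' i) : PolyBound f g' :=
  h'.trans (of_le h)

theorem add (h₁ : PolyBound f g) (h₂ : PolyBound f' g) : PolyBound (fun i => f i + f' i) g := by
  obtain ⟨q, hq⟩ := h₁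
  obtain ⟨r, hr⟩ := h₂
  exact ⟨q + r, fun i => by rw [Polynomial.eval_add]; exact add_le_add (hq i) (hr i)⟩

theorem mul (h₁ : PolyBound f g) (h₂ : PolyBound f' g) : PolyBound (fun i => f i * f' i) g := by
  obtain ⟨q, hq⟩ := h₁
  obtain ⟨r, hr⟩ := h₂
  exact ⟨q * r, fun i => by rw [Polynomial.eval_mul]; exact Nat.mul_le_mul (hq i) (hr i)⟩

theorem reindex (h : PolyBound f g) (e : κ → ι) : PolyBound (fun k => f (e k)) fun k => g (e k) := by
  obtain ⟨q, hq⟩ := h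
  exact ⟨q, fun k => hq (e k)⟩

end PolyBound

/-! ## Sizes -/

namespace Data

theorem one_le_size (d : Data) : 1 ≤ d.size := by cases d <;> simp [size]

theorem size_fst_le (d : Data) : d.fst.size ≤ d.size := by
  cases d <;> simp [size, fst]; omega

theorem size_snd_le (d : Data) : d.snd.size ≤ d.size := by
  cases d <;> simp [size, snd]; omega

theorem size_ofList (l : List Data) : (ofList l).size = (l.map fun d => d.size + 1).sum + 1 := by
  induction l with
  | nil => rfl
  | cons a l ih => simp only [ofList, size, List.map_cons, List.sum_cons, ih]; ring

theorem length_le_size_ofList (l : List Data) : l.length ≤ (ofList l).size := by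
  induction l with
  | nil => simp
  | cons a l ih => simp only [ofList, size, List.length_cons]; omega

theorem size_le_size_ofList {l : List Data} {d : Data} (h : d ∈ l) : d.size ≤ (ofList l).size := by
  induction l with
  | nil => simp at h
  | cons a l ih =>
    simp only [ofList, size]
    rcases List.mem_cons.1 h with rfl | h
    · omega
    · have := ih h; omega

theorem size_ofList_le {l : List Data} {n s : ℕ} (hn : l.length ≤ n) (hs : ∀ d ∈ l, d.size ≤ s) :
    (ofList l).size ≤ n * (s + 1) + 1 := by
  rw [size_ofList]
  have : (l.map fun d => d.size + 1).sum ≤ (l.map fun d => d.size + 1).length • (s + 1) :=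
    List.sum_le_card_nsmul _ _ (by simpa using hs)
  rw [List.length_map, smul_eq_mul] at this
  have := Nat.mul_le_mul_right (s + 1) hn
  omega

theorem size_ofList_append (l l' : List Data) :
    (ofList (l ++ l')).size + 1 = (ofList l).size + (ofList l').size := by
  simp only [size_ofList, List.map_append, List.sum_append]; ring

end Data

/-- Each rule charges at least the size of its input, so a time bound is also a bound on the output;
this is what lets polynomial bounds compose. -/
theorem Runs.size_le {p : Prog} {x y : Data} {t : ℕ} (h : Runs p x y t) : y.size ≤ t := by
  induction h with
  | id x => exact le_rfl
  | nil x => exact x.one_le_size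
  | fst x => exact x.size_fst_le
  | snd x => exact x.size_snd_le
  | @cons p q x a b s t _ _ h₁ h₂ => have := x.one_le_size; simp only [Data.size]; omega
  | _ => omega

/-! ## Functions computable in polynomial time -/

/-- A single program maps `E i` to `F i`, for all `i`, in time polynomial in the size of `E i`. -/
def PolyTime {ι : Type} (E F : ι → Data) : Prop :=
  ∃ (p : Prog) (t : ι → ℕ), PolyBound t (fun i => (E i).size) ∧ ∀ i, Runs p (E i) (F i) (t i)

namespace PolyTime

open Data (ofList)

variable {ι κ : Type} {E F G : ι → Data}

theorem of_exists (p : Prog) {B : ι → ℕ} (hB : PolyBound B fun i => (E i).size)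
    (h : ∀ i, ∃ t ≤ B i, Runs p (E i) (F i) t) : PolyTime E F := by
  choose t ht hr using h
  exact ⟨p, t, hB.mono_left ht, hr⟩

theorem size (h : PolyTime E F) : PolyBound (fun i => (F i).size) fun i => (E i).size := by
  obtain ⟨p, t, ht, hr⟩ := h
  exact ht.mono_left fun i => (hr i).size_le

theorem id (E : ι → Data) : PolyTime E E :=
  ⟨.id, _, .refl _, fun _ => .id _⟩

theorem comp (h₁ : PolyTime E F) (h₂ : PolyTime F G) : PolyTime E G := by
  have hs := h₁.size
  obtain ⟨p, t, ht, hr⟩ := h₁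
  obtain ⟨p', t', ht', hr'⟩ := h₂
  exact ⟨.seq p p', _, ht.add (ht'.trans hs), fun i => .seq (hr i) (hr' i)⟩

theorem pair (h₁ : PolyTime E F) (h₂ : PolyTime E G) :
    PolyTime E fun i => .cons (F i) (G i) := by
  obtain ⟨p, t, ht, hr⟩ := h₁
  obtain ⟨p', t', ht', hr'⟩ := h₂
  exact ⟨.cons p p', _, ((PolyBound.refl _).add ht).add ht', fun i => .cons (hr i) (hr' i)⟩

theorem reindex (h : PolyTime E F) (e : κ → ι) :
    PolyTime (fun k => E (e k)) fun k => F (e k) := by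
  obtain ⟨p, t, ht, hr⟩ := h
  exact ⟨p, _, ht.reindex e, fun k => hr (e k)⟩

theorem data_fst (h : PolyTime E F) : PolyTime E fun i => (F i).fst :=
  h.comp ⟨.fst, _, .refl _, fun _ => .fst _⟩

theorem data_snd (h : PolyTime E F) : PolyTime E fun i => (F i).snd :=
  h.comp ⟨.snd, _, .refl _, fun _ => .snd _⟩

theorem fst (h : PolyTime E fun i => .cons (F i) (G i)) : PolyTime E F := h.data_fst

theorem snd (h : PolyTime E fun i => .cons (F i) (G i)) : PolyTime E G := h.data_snd

theorem nil (E : ι → Data) : PolyTime E fun _ => .nil :=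
  ⟨.nil, _, .refl _, fun _ => .nil _⟩

theorem const (E : ι → Data) (d : Data) : PolyTime E fun _ => d := by
  induction d with
  | nil => exact nil E
  | cons a b iha ihb => exact iha.pair ihb

theorem congr (h : PolyTime E F) (hFG : ∀ i, F i = G i) : PolyTime E G := by
  rwa [← funext hFG]

/-- Case distinction; each branch need only work where it is taken. -/
theorem cond {C : ι → Data} {p : ι → Prop} [DecidablePred p] (hC : PolyTime E C)
    (hp : ∀ i, C i ≠ .nil ↔ p i)
    (hF : PolyTime (fun i : {i // p i} => E i) fun i => F i)
    (hG : PolyTime (fun i : {i // ¬ p i} => E i) fun i => G i) :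
    PolyTime E fun i => if p i then F i else G i := by
  obtain ⟨c, t, ⟨a, ht⟩, hr⟩ := hC
  obtain ⟨f, t', ⟨a', ht'⟩, hr'⟩ := hF
  obtain ⟨g, t'', ⟨a'', ht''⟩, hr''⟩ := hG
  refine of_exists (.cond c f g)
    (B := fun i => (E i).size + a.eval (E i).size + (a'.eval (E i).size + a''.eval (E i).size))
    (((PolyBound.refl _).add ⟨a, fun i => le_rfl⟩).add ⟨a' + a'', fun i => by simp⟩)
    fun i => ?_
  have h : t i ≤ a.eval (E i).size := ht i
  by_cases hi : p i
  · have h' : t' ⟨i, hi⟩ ≤ a'.eval (E i).size := ht' ⟨i, hi⟩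
    refine ⟨_, ?_, by rw [if_pos hi]; exact .cond_true (hr i) ((hp i).2 hi) (hr' ⟨i, hi⟩)⟩
    omega
  · have h' : t'' ⟨i, hi⟩ ≤ a''.eval (E i).size := ht'' ⟨i, hi⟩
    have hn : C i = .nil := not_not.1 fun h => hi ((hp i).1 h)
    refine ⟨_, ?_, by rw [if_neg hi]; exact .cond_false (hn ▸ hr i) (hr'' ⟨i, hi⟩)⟩
    omega

theorem ite {p : ι → Prop} [DecidablePred p] (hp : PolyTime E fun i => .ofBool (decide (p i)))
    (hF : PolyTime E F) (hG : PolyTime E G) : PolyTime E fun i => if p i then F i else G i :=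
  cond hp (fun i => by by_cases h : p i <;> simp [h, Data.ofBool])
    (hF.reindex Subtype.val) (hG.reindex Subtype.val)

/-- Here `st i j` is the value after `j` rounds. The bound on all these values is a separate
hypothesis: a body of polynomial cost could square the size in every round. Test and body need only
be correct on values that are actually reached. -/
theorem loop {N : ι → ℕ} {st : ι → ℕ → Data} {c : ι → ℕ → Data} (h0 : ∀ i, st i 0 = E i)
    (hc : PolyTime (fun x : Σ i, {j // j ≤ N i} => st x.1 x.2) fun x => c x.1 x.2)
    (hc₁ : ∀ i, ∀ j < N i, c i j ≠ .nil) (hc₂ : ∀ i, c i (N i) = .nil)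
    (hb : PolyTime (fun x : Σ i, {j // j < N i} => st x.1 x.2) fun x => st x.1 (x.2 + 1))
    (hN : PolyBound N fun i => (E i).size)
    (hs : PolyBound (fun x : Σ i, {j // j ≤ N i} => (st x.1 x.2).size) fun x => (E x.1).size) :
    PolyTime E fun i => st i (N i) := by
  obtain ⟨p, t, ⟨a, ht⟩, hr⟩ := hc
  obtain ⟨p', t', ⟨a', ht'⟩, hr'⟩ := hb
  obtain ⟨q, hq⟩ := hs
  -- The cost of one round: `X` for the charge on the current value, `a` for the test, `a'` for the
  -- body. The factor `N i + 1` below includes the last test, which fails.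
  let M : ι → ℕ := fun i => (Polynomial.X + a + a').eval (q.eval (E i).size)
  have hM : PolyBound M fun i => (E i).size :=
    ⟨(Polynomial.X + a + a').comp q, fun i => by rw [Polynomial.eval_comp]⟩
  refine of_exists (.loop p p') (B := fun i => (N i + 1) * M i)
    ((hN.add (.const 1 _)).mul hM) fun i => ?_
  have bound : ∀ j ≤ N i, (st i j).size + a.eval (st i j).size + a'.eval (st i j).size ≤ M i := by
    intro j hj
    have := polynomial_eval_mono (Polynomial.X + a + a') (hq ⟨i, j, hj⟩)
    simpa [M] using this
  suffices H : ∀ d j, j + d = N i → ∃ t ≤ (d + 1) * M i,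
      Runs (.loop p p') (st i j) (st i (N i)) t by
    obtain ⟨t, ht, h⟩ := H (N i) 0 (zero_add _)
    exact ⟨t, ht, h0 i ▸ h⟩
  intro d
  induction d with
  | zero =>
    rintro j rfl
    have h := hr ⟨i, N i, le_rfl⟩
    have h1 := ht ⟨i, N i, le_rfl⟩
    have h2 := bound (N i) le_rfl
    simp only [hc₂] at h
    refine ⟨_, ?_, .loop_false h⟩
    simp only at h1 ⊢
    omega
  | succ d ih =>
    intro j hj
    obtain ⟨u, hu, hru⟩ := ih (j + 1) (by omega)
    have h1 := ht ⟨i, j, by omega⟩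
    have h2 := ht' ⟨i, j, by omega⟩
    have h3 := bound j (by omega)
    refine ⟨_, ?_, .loop_true (hr ⟨i, j, by omega⟩) (hc₁ i j (by omega)) (hr' ⟨i, j, by omega⟩) hru⟩
    simp only at h1 h2
    have : (d + 1 + 1) * M i = (d + 1) * M i + M i := by ring
    omega

/-- Left folds over lists, if the intermediate values are bounded by a polynomial. -/
theorem foldl_of_prefix {β σ : ι → Type} {eβ : ∀ i, β i → Data} {eσ : ∀ i, σ i → Data}
    {L : ∀ i, List (β i)} {s₀ : ∀ i, σ i} {step : ∀ i, σ i → β i → σ i}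
    (hL : PolyTime E fun i => ofList ((L i).map (eβ i))) (h₀ : PolyTime E fun i => eσ i (s₀ i))
    (hs : PolyBound
      (fun x : Σ i, {j // j ≤ (L i).length} =>
        (eσ x.1 (((L x.1).take x.2).foldl (step x.1) (s₀ x.1))).size) fun x => (E x.1).size)
    (hstep : PolyTime
      (fun x : Σ i, {j // j < (L i).length} =>
        .cons (E x.1) (.cons (eσ x.1 (((L x.1).take x.2).foldl (step x.1) (s₀ x.1)))
          (eβ x.1 ((L x.1)[x.2.1]'x.2.2))))
      fun x => eσ x.1 (step x.1 (((L x.1).take x.2).foldl (step x.1) (s₀ x.1))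
        ((L x.1)[x.2.1]'x.2.2))) :
    PolyTime E fun i => eσ i ((L i).foldl (step i) (s₀ i)) := by
  -- The loop carries the input along with the rest of the list and the accumulator, since the step
  -- may consult the input.
  let st : ι → ℕ → Data := fun i j => .cons (E i) (.cons (ofList (((L i).drop j).map (eβ i)))
    (eσ i (((L i).take j).foldl (step i) (s₀ i))))
  have h1 : PolyTime E fun i => st i 0 :=
    (id E).pair (hL.pair h₀)
  have le1 : ∀ i, (E i).size ≤ (st i 0).size := fun i => by simp only [st, Data.size]; omega
  have key : PolyTime (fun i => st i 0) fun i => st i (L i).length := by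
    refine loop (c := fun i j => ofList (((L i).drop j).map (eβ i))) (fun i => rfl)
      (id _).snd.fst ?_ ?_ ?_ ?_ ?_
    · intro i j hj
      rw [List.drop_eq_getElem_cons hj]
      simp only [List.map_cons, ofList]
      exact fun h => by cases h
    · intro i; simp [ofList]
    · have hid := id (fun x : Σ i, {j // j < (L i).length} => st x.1 x.2)
      have hE := hid.fst
      have hr := hid.snd.fst
      have hs := hid.snd.snd
      have e : ∀ x : Σ i, {j // j < (L i).length}, ofList (((L x.1).drop x.2).map (eβ x.1)) =
          .cons (eβ x.1 ((L x.1)[x.2.1]'x.2.2)) (ofList (((L x.1).drop (x.2 + 1)).map (eβ x.1))) := by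
        intro x
        rw [List.drop_eq_getElem_cons x.2.2]
        rfl
      have hr := hr.congr e
      refine (hE.pair (hr.snd.pair ((hE.pair (hs.pair hr.fst)).comp hstep))).congr fun x => ?_
      simp only [st]
      rw [List.take_add_one, List.getElem?_eq_getElem x.2.2, List.foldl_append]
      rfl
    · have : PolyBound (fun i => (L i).length) fun i => (E i).size :=
        hL.size.mono_left fun i => by
          simpa using Data.length_le_size_ofList ((L i).map (eβ i))
      exact this.mono_right le1
    · have h2 : PolyBound (fun x : Σ i, {j // j ≤ (L i).length} =>
          (ofList (((L x.1).drop x.2).map (eβ x.1))).size) fun x => (E x.1).size := by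
        refine (hL.size.reindex Sigma.fst).mono_left fun x => ?_
        have := Data.size_ofList_append (((L x.1).take x.2).map (eβ x.1))
          (((L x.1).drop x.2).map (eβ x.1))
        rw [← List.map_append, List.take_append_drop] at this
        have := Data.one_le_size (ofList (((L x.1).take x.2).map (eβ x.1)))
        omega
      have h3 := (((PolyBound.refl (fun x : Σ i, {j // j ≤ (L i).length} => (E x.1).size)).add
        (h2.add hs)).add (.const 2 _)).mono_right fun x => le1 x.1
      refine h3.mono_left fun x => ?_
      simp only [st, Data.size]; omega
  refine ((h1.comp key).snd.snd).congr fun i => ?_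
  rw [List.take_length]

/-- Left folds over lists, if the values that satisfy an invariant are bounded by a polynomial. -/
theorem foldl {β σ : ι → Type} {eβ : ∀ i, β i → Data} {eσ : ∀ i, σ i → Data}
    {L : ∀ i, List (β i)} {s₀ : ∀ i, σ i} {step : ∀ i, σ i → β i → σ i}
    (inv : ∀ i, σ i → Prop)
    (hL : PolyTime E fun i => ofList ((L i).map (eβ i))) (h₀ : PolyTime E fun i => eσ i (s₀ i))
    (inv₀ : ∀ i, inv i (s₀ i)) (inv_step : ∀ i s, ∀ b ∈ L i, inv i s → inv i (step i s b))
    (hs : PolyBound (fun x : Σ i, {s // inv i s} => (eσ x.1 x.2).size) fun x => (E x.1).size)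
    (hstep : PolyTime
      (fun x : Σ i, ({s // inv i s} × {b // b ∈ L i}) =>
        .cons (E x.1) (.cons (eσ x.1 x.2.1) (eβ x.1 x.2.2)))
      fun x => eσ x.1 (step x.1 x.2.1 x.2.2)) :
    PolyTime E fun i => eσ i ((L i).foldl (step i) (s₀ i)) := by
  have H : ∀ i, ∀ l : List (β i), (∀ b ∈ l, b ∈ L i) → inv i (l.foldl (step i) (s₀ i)) := by
    intro i l
    induction l using List.reverseRecOn with
    | nil => intro _; exact inv₀ i
    | append_singleton l b ih =>
      intro h
      rw [List.foldl_append]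
      exact inv_step i _ b (h b (by simp)) (ih fun b' hb' => h b' (by simp [hb']))
  have H' : ∀ i j, inv i (((L i).take j).foldl (step i) (s₀ i)) := fun i j =>
    H i _ fun b hb => List.mem_of_mem_take hb
  exact foldl_of_prefix hL h₀ (hs.reindex fun x : Σ i, {j // j ≤ (L i).length} => ⟨x.1, _, H' x.1 x.2⟩)
    (hstep.reindex fun x : Σ i, {j // j < (L i).length} => ⟨x.1, ⟨_, H' x.1 x.2⟩, ⟨_, List.getElem_mem x.2.2⟩⟩)

end PolyTime

/-! ### Operations on encoded lists and Booleans -/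

theorem Data.size_ofList_mono {l l' : List Data} (h : l.Sublist l') :
    (ofList l).size ≤ (ofList l').size := by
  induction h with
  | slnil => exact le_rfl
  | cons a _ ih => simp only [ofList, size]; omega
  | cons_cons a _ ih => simp only [ofList, size]; omega

theorem Data.size_ofList_flatMap_le {β : Type} {F : β → List Data} {l : List β} {n s : ℕ}
    (hn : l.length ≤ n) (hs : ∀ b ∈ l, (ofList (F b)).size ≤ s) :
    (ofList (l.flatMap F)).size ≤ n * s + 1 := by
  induction l generalizing n with
  | nil => simp [ofList, size]
  | cons a l ih =>
    obtain ⟨n, rfl⟩ : ∃ m, n = m + 1 := ⟨n - 1, by simp at hn; omega⟩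
    have h1 := ih (n := n) (by simpa using hn) fun b hb => hs b (by simp [hb])
    have h2 := hs a (by simp)
    have h3 := size_ofList_append (F a) (l.flatMap F)
    rw [List.flatMap_cons]
    have : (n + 1) * s = n * s + s := by ring
    omega

namespace PolyTime

open Data (ofList)

variable {ι : Type} {E : ι → Data}

theorem reverse {L : ι → List Data} (hL : PolyTime E fun i => ofList (L i)) :
    PolyTime E fun i => ofList (L i).reverse := by
  have e : ∀ l : List Data, l.foldl (fun acc d => d :: acc) [] = l.reverse := fun l => by simp
  have := foldl_of_prefix (β := fun _ => Data) (σ := fun _ => List Data) (eβ := fun _ d => d)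
    (eσ := fun _ => ofList) (L := L) (s₀ := fun _ => []) (step := fun _ acc d => d :: acc)
    (by simpa using hL) (nil E) ?_ ?_
  · exact this.congr fun i => by rw [e]
  · refine (hL.size.reindex Sigma.fst).mono_left fun x => ?_
    rw [e]
    have : (ofList ((L x.1).take x.2).reverse).size = (ofList ((L x.1).take x.2)).size := by
      simp [Data.size_ofList]
    rw [this]
    exact Data.size_ofList_mono (List.take_sublist _ _)
  · exact (id _).snd.snd.pair (id _).snd.fst

theorem append {L L' : ι → List Data} (hL : PolyTime E fun i => ofList (L i))
    (hL' : PolyTime E fun i => ofList (L' i)) : PolyTime E fun i => ofList (L i ++ L' i) := by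
  have e : ∀ l l' : List Data, l.foldl (fun acc d => d :: acc) l' = l.reverse ++ l' := fun l l' => by simp
  have := foldl_of_prefix (β := fun _ => Data) (σ := fun _ => List Data) (eβ := fun _ d => d)
    (eσ := fun _ => ofList) (L := fun i => (L i).reverse) (s₀ := L')
    (step := fun _ acc d => d :: acc) (by simpa using hL.reverse) hL' ?_ ?_
  · exact this.congr fun i => by rw [e, List.reverse_reverse]
  · refine ((hL.size.add hL'.size).reindex Sigma.fst).mono_left fun x => ?_
    rw [e]
    have h1 := Data.size_ofList_append ((L x.1).reverse.take x.2).reverse (L' x.1)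
    have h2 : (ofList ((L x.1).reverse.take x.2).reverse).size =
        (ofList ((L x.1).reverse.take x.2)).size := by
      simp [Data.size_ofList]
    have h3 := Data.size_ofList_mono (List.take_sublist x.2 (L x.1).reverse)
    have h4 : (ofList (L x.1).reverse).size = (ofList (L x.1)).size := by simp [Data.size_ofList]
    omega
  · exact (id _).snd.snd.pair (id _).snd.fst

section

variable {β : ι → Type} {eβ : ∀ i, β i → Data} {L : ∀ i, List (β i)}

/-- An input extended by an element of a computable list is polynomially bounded in the input alone,
so bounds inside a loop body turn into bounds outside, uniformly in the element. -/
theorem size_elem (hL : PolyTime E fun i => ofList ((L i).map (eβ i))) :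
    PolyBound (fun x : Σ i, {b // b ∈ L i} => (Data.cons (E x.1) (eβ x.1 x.2)).size)
      fun x => (E x.1).size := by
  refine (((PolyBound.refl fun x : Σ i, {b // b ∈ L i} => (E x.1).size).add
    (hL.size.reindex Sigma.fst)).add (.const 1 _)).mono_left fun x => ?_
  have := Data.size_le_size_ofList (List.mem_map_of_mem (f := eβ x.1) x.2.2)
  simp only [Data.size]
  omega

theorem length (hL : PolyTime E fun i => ofList ((L i).map (eβ i))) :
    PolyBound (fun i => (L i).length) fun i => (E i).size :=
  hL.size.mono_left fun i => by simpa using Data.length_le_size_ofList ((L i).map (eβ i))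

theorem flatMap {F : ∀ i, β i → List Data} (hL : PolyTime E fun i => ofList ((L i).map (eβ i)))
    (hF : PolyTime (fun x : Σ i, {b // b ∈ L i} => .cons (E x.1) (eβ x.1 x.2))
      fun x => ofList (F x.1 x.2)) :
    PolyTime E fun i => ofList ((L i).flatMap (F i)) := by
  have e : ∀ i (l : List (β i)), l.foldl (fun acc b => acc ++ F i b) [] = l.flatMap (F i) := by
    intro i l
    induction l using List.reverseRecOn with
    | nil => rfl
    | append_singleton l b ih => simp [List.foldl_append, ih]
  have := foldl_of_prefix (σ := fun _ => List Data) (eσ := fun _ => ofList) (s₀ := fun _ => [])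
    (step := fun i acc b => acc ++ F i b) hL (nil E) ?_ ?_
  · exact this.congr fun i => by rw [e]
  · obtain ⟨q, hq⟩ := hF.size.trans hL.size_elem
    refine (((hL.length.mul ⟨q, fun i => le_rfl⟩).add (.const 1 _)).reindex
      Sigma.fst).mono_left fun x => ?_
    rw [e]
    refine Data.size_ofList_flatMap_le (by simp) fun b hb => ?_
    exact hq ⟨x.1, b, List.mem_of_mem_take hb⟩
  · have hid := id (fun x : Σ i, {j // j < (L i).length} =>
      Data.cons (E x.1) (.cons (ofList (((L x.1).take x.2).foldl (fun acc b => acc ++ F x.1 b) []))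
        (eβ x.1 ((L x.1)[x.2.1]'x.2.2))))
    refine append hid.snd.fst ((hid.fst.pair hid.snd.snd).comp (hF.reindex
      fun x : Σ i, {j // j < (L i).length} => ⟨x.1, _, List.getElem_mem x.2.2⟩))

theorem map {F : ∀ i, β i → Data} (hL : PolyTime E fun i => ofList ((L i).map (eβ i)))
    (hF : PolyTime (fun x : Σ i, {b // b ∈ L i} => .cons (E x.1) (eβ x.1 x.2))
      fun x => F x.1 x.2) :
    PolyTime E fun i => ofList ((L i).map (F i)) :=
  (hL.flatMap (F := fun i b => [F i b]) (hF.pair (nil _))).congr fun i => by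
    rw [List.map_eq_flatMap]

theorem filter {p : ∀ i, β i → Bool} (hL : PolyTime E fun i => ofList ((L i).map (eβ i)))
    (hp : PolyTime (fun x : Σ i, {b // b ∈ L i} => .cons (E x.1) (eβ x.1 x.2))
      fun x => .ofBool (p x.1 x.2)) :
    PolyTime E fun i => ofList (((L i).filter (p i)).map (eβ i)) := by
  refine (hL.flatMap (F := fun i b => if p i b then [eβ i b] else []) ?_).congr fun i => ?_
  · have := ite (p := fun x : Σ i, {b // b ∈ L i} => p x.1 x.2 = true)
      (hp.congr fun x => by rw [Bool.decide_eq_true])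
      ((id fun x : Σ i, {b // b ∈ L i} => Data.cons (E x.1) (eβ x.1 x.2)).snd.pair (nil _)) (nil _)
    exact this.congr fun x => by split_ifs <;> rfl
  · congr 1
    induction L i with
    | nil => rfl
    | cons b l ih => by_cases h : p i b <;> simp [h, ih]

theorem not {b : ι → Bool} (h : PolyTime E fun i => .ofBool (b i)) :
    PolyTime E fun i => .ofBool (!b i) :=
  (ite (p := fun i => b i = true) (h.congr fun i => by rw [Bool.decide_eq_true])
    (const E (.ofBool false)) (const E (.ofBool true))).congr fun i => by cases b i <;> rfl

theorem and {b c : ι → Bool} (h : PolyTime E fun i => .ofBool (b i))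
    (h' : PolyTime E fun i => .ofBool (c i)) : PolyTime E fun i => .ofBool (b i && c i) :=
  (ite (p := fun i => b i = true) (h.congr fun i => by rw [Bool.decide_eq_true])
    h' (const E (.ofBool false))).congr fun i => by cases b i <;> rfl

theorem or {b c : ι → Bool} (h : PolyTime E fun i => .ofBool (b i))
    (h' : PolyTime E fun i => .ofBool (c i)) : PolyTime E fun i => .ofBool (b i || c i) :=
  (ite (p := fun i => b i = true) (h.congr fun i => by rw [Bool.decide_eq_true])
    (const E (.ofBool true)) h').congr fun i => by cases b i <;> rfl

theorem isEmpty (hL : PolyTime E fun i => ofList ((L i).map (eβ i))) :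
    PolyTime E fun i => .ofBool (L i).isEmpty := by
  refine (cond (p := fun i => (L i).isEmpty = false) (F := fun _ => .ofBool false)
    (G := fun _ => .ofBool true) hL (fun i => ?_) (const _ _) (const _ _)).congr fun i => ?_
  · cases L i <;> simp [ofList]
  · cases L i <;> simp

theorem all {p : ∀ i, β i → Bool} (hL : PolyTime E fun i => ofList ((L i).map (eβ i)))
    (hp : PolyTime (fun x : Σ i, {b // b ∈ L i} => .cons (E x.1) (eβ x.1 x.2))
      fun x => .ofBool (p x.1 x.2)) :
    PolyTime E fun i => .ofBool ((L i).all (p i)) :=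
  (hL.filter (p := fun i b => !p i b) hp.not).isEmpty.congr fun i => by
    congr 1
    induction L i with
    | nil => rfl
    | cons b l ih => by_cases h : p i b <;> simp [h, ih]

end

end PolyTime

/-! ## Binary arithmetic -/

namespace Data

theorem ofNat_zero : ofNat 0 = nil := by simp [ofNat, ofList]

/-- The hypothesis excludes a leading zero: the expansion of `0` is empty, so `Nat.bit false 0` does
not gain a digit. -/
theorem ofNat_bit {b : Bool} {n : ℕ} (h : n = 0 → b = true) :
    ofNat (Nat.bit b n) = cons (ofBool b) (ofNat n) := by
  rw [ofNat, Nat.bits_append_bit n b h]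
  rfl

theorem ofNat_of_pos {n : ℕ} (hn : 0 < n) :
    ofNat n = cons (ofBool n.bodd) (ofNat n.div2) := by
  have h : n.div2 = 0 → n.bodd = true := fun h => by
    have := Nat.bodd_add_div2 n
    rw [h] at this
    cases hb : n.bodd
    · simp [hb] at this; omega
    · rfl
  conv_lhs => rw [← Nat.bit_bodd_div2 n, ofNat_bit h]

theorem ofNat_fst (n : ℕ) : (ofNat n).fst = ofBool n.bodd := by
  rcases Nat.eq_zero_or_pos n with rfl | hn
  · rfl
  · rw [ofNat_of_pos hn]
    rfl

theorem ofNat_snd (n : ℕ) : (ofNat n).snd = ofNat n.div2 := by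
  rcases Nat.eq_zero_or_pos n with rfl | hn
  · rfl
  · rw [ofNat_of_pos hn]
    rfl

theorem ofNat_ne_nil {n : ℕ} : ofNat n ≠ nil ↔ n ≠ 0 := by
  refine not_congr ⟨fun h => ?_, fun h => by rw [h, ofNat_zero]⟩
  by_contra hn
  rw [ofNat_of_pos (Nat.pos_of_ne_zero hn)] at h
  cases h

theorem size_ofNat_le (n : ℕ) : (ofNat n).size ≤ 4 * n.size + 1 := by
  have := size_ofList_le (l := n.bits.map ofBool) (n := n.size) (s := 3)
    (by simp [Nat.size_eq_bits_len]) fun d hd => by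
      obtain ⟨b, _, rfl⟩ := List.mem_map.1 hd
      cases b <;> simp [ofBool, size]
  rw [ofNat]
  omega

theorem nat_size_le (n : ℕ) : n.size ≤ (ofNat n).size := by
  have := length_le_size_ofList (n.bits.map ofBool)
  rwa [List.length_map, Nat.size_eq_bits_len] at this

theorem size_ofNat_mono {a b : ℕ} (h : a ≤ b) : (ofNat a).size ≤ 4 * (ofNat b).size + 1 := by
  have := size_ofNat_le a
  have := nat_size_le b
  have := Nat.size_le_size h
  omega

end Data

/-- One step of the addition of binary numbers. -/
def addStep (s : ℕ × ℕ × Bool × List Bool) : ℕ × ℕ × Bool × List Bool :=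
  (s.1.div2, s.2.1.div2,
    (s.1.bodd && s.2.1.bodd || s.2.2.1 && (s.1.bodd || s.2.1.bodd)),
    (s.1.bodd ^^ s.2.1.bodd ^^ s.2.2.1) :: s.2.2.2)

/-- One step of the comparison of binary numbers. -/
def leStep (s : ℕ × ℕ × Bool) : ℕ × ℕ × Bool :=
  (s.1.div2, s.2.1.div2,
    (!s.1.bodd && s.2.1.bodd || s.2.2 && (!s.1.bodd || s.2.1.bodd)))

theorem div2_lt_two_pow {x n : ℕ} (h : x < 2 ^ (n + 1)) : x.div2 < 2 ^ n := by
  rw [Nat.div2_val]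
  rw [pow_succ] at h
  omega

/-- The list only serves as a clock, long enough to use up both summands. Digits are pushed least
significant first, so folding `Nat.bit` over the accumulator restores the low part below whatever is
still to be added; this total value is invariant. -/
theorem foldl_addStep {α : Type} (l : List α) (s : ℕ × ℕ × Bool × List Bool)
    (h1 : s.1 < 2 ^ l.length) (h2 : s.2.1 < 2 ^ l.length) :
    (l.foldl (fun s _ => addStep s) s).2.2.2.foldl (fun v b => Nat.bit b v)
      (l.foldl (fun s _ => addStep s) s).2.2.1.toNat =
    s.2.2.2.foldl (fun v b => Nat.bit b v) (s.1 + s.2.1 + s.2.2.1.toNat) := by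
  induction l generalizing s with
  | nil =>
    have : s.1 = 0 := by simpa using h1
    have : s.2.1 = 0 := by simpa using h2
    simp [*]
  | cons a l ih =>
    rw [List.foldl_cons, ih _ (div2_lt_two_pow h1) (div2_lt_two_pow h2)]
    obtain ⟨x, y, c, acc⟩ := s
    simp only [addStep, List.foldl_cons]
    congr 1
    have hx := Nat.bodd_add_div2 x
    have hy := Nat.bodd_add_div2 y
    rw [Nat.bit_val]
    cases c <;> cases hbx : x.bodd <;> cases hby : y.bodd <;> simp [hbx, hby] at hx hy ⊢ <;> omega

theorem length_foldl_addStep {α : Type} (l : List α) (s : ℕ × ℕ × Bool × List Bool) :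
    (l.foldl (fun s _ => addStep s) s).2.2.2.length = l.length + s.2.2.2.length ∧
    (l.foldl (fun s _ => addStep s) s).1 ≤ s.1 ∧
    (l.foldl (fun s _ => addStep s) s).2.1 ≤ s.2.1 := by
  induction l generalizing s with
  | nil => simp
  | cons a l ih =>
    rw [List.foldl_cons]
    obtain ⟨h1, h2, h3⟩ := ih (addStep s)
    refine ⟨by rw [h1]; simp [addStep]; omega, h2.trans ?_, h3.trans ?_⟩
    · simp only [addStep, Nat.div2_val]; omega
    · simp only [addStep, Nat.div2_val]; omega

/-- The flag is the result of comparing the digits read so far. A difference in a higher digit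
overrides it, equality keeps it; starting from `true` gives `≤`. -/
theorem foldl_leStep {α : Type} (l : List α) (s : ℕ × ℕ × Bool)
    (h1 : s.1 < 2 ^ l.length) (h2 : s.2.1 < 2 ^ l.length) :
    (l.foldl (fun s _ => leStep s) s).2.2 = decide (s.1 < s.2.1 ∨ s.1 = s.2.1 ∧ s.2.2 = true) := by
  induction l generalizing s with
  | nil =>
    have : s.1 = 0 := by simpa using h1
    have : s.2.1 = 0 := by simpa using h2
    simp [*]
  | cons a l ih =>
    rw [List.foldl_cons, ih _ (div2_lt_two_pow h1) (div2_lt_two_pow h2)]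
    obtain ⟨x, y, c⟩ := s
    rw [Bool.eq_iff_iff, decide_eq_true_eq, decide_eq_true_eq]
    simp only [leStep]
    have hx := Nat.bodd_add_div2 x
    have hy := Nat.bodd_add_div2 y
    cases c <;> cases hbx : x.bodd <;> cases hby : y.bodd <;> simp [hbx, hby] at hx hy ⊢ <;> omega

theorem foldl_leStep_le {α : Type} (l : List α) (s : ℕ × ℕ × Bool) :
    (l.foldl (fun s _ => leStep s) s).1 ≤ s.1 ∧ (l.foldl (fun s _ => leStep s) s).2.1 ≤ s.2.1 := by
  induction l generalizing s with
  | nil => simp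
  | cons a l ih =>
    rw [List.foldl_cons]
    obtain ⟨h2, h3⟩ := ih (leStep s)
    refine ⟨h2.trans ?_, h3.trans ?_⟩
    · simp only [leStep, Nat.div2_val]; omega
    · simp only [leStep, Nat.div2_val]; omega

/-- Horner's scheme: multiplication by doubling and adding. -/
theorem foldr_bits_mul (a b : ℕ) :
    b.bits.foldr (fun c v => v + v + if c then a else 0) 0 = a * b := by
  induction b using Nat.binaryRec' with
  | zero => simp
  | bit c n h ih =>
    rw [Nat.bits_append_bit n c h, List.foldr_cons, ih, Nat.bit_val]
    cases c <;> simp <;> ring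

/-- Each step at most doubles `v + a`, which bounds the intermediate values of the multiplication.
-/
theorem foldl_mul_le (a : ℕ) (l : List Bool) (v : ℕ) :
    l.foldl (fun v c => v + v + if c then a else 0) v + a ≤ (v + a) * 2 ^ l.length := by
  induction l generalizing v with
  | nil => simp
  | cons c l ih =>
    rw [List.foldl_cons]
    refine (ih _).trans ?_
    rw [List.length_cons, pow_succ, mul_comm _ 2, ← mul_assoc]
    refine Nat.mul_le_mul_right _ ?_
    split_ifs <;> omega

namespace PolyTime

open Data (ofList ofNat ofBool)

variable {ι : Type} {E : ι → Data}

theorem nat_bit {b : ι → Bool} {n : ι → ℕ} (hb : PolyTime E fun i => ofBool (b i))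
    (hn : PolyTime E fun i => ofNat (n i)) : PolyTime E fun i => ofNat (Nat.bit (b i) (n i)) := by
  refine (cond (p := fun i => n i ≠ 0) (F := fun i => .cons (ofBool (b i)) (ofNat (n i)))
    (G := fun i => if b i = true then ofNat 1 else .nil) hn (fun i => Data.ofNat_ne_nil)
    ((hb.pair hn).reindex Subtype.val) ((ite (p := fun i => b i = true)
      (hb.congr fun i => by rw [Bool.decide_eq_true]) (const E (ofNat 1)) (nil E)).reindex
        Subtype.val)).congr fun i => ?_
  by_cases h : n i = 0
  · cases hb : b i
    · simp [h, Data.ofNat_zero]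
    · simp [h]
  · rw [if_pos h, Data.ofNat_bit fun h' => absurd h' h]

theorem nat_bodd {n : ι → ℕ} (hn : PolyTime E fun i => ofNat (n i)) :
    PolyTime E fun i => ofBool (n i).bodd :=
  hn.data_fst.congr fun i => Data.ofNat_fst (n i)

theorem nat_div2 {n : ι → ℕ} (hn : PolyTime E fun i => ofNat (n i)) :
    PolyTime E fun i => ofNat (n i).div2 :=
  hn.data_snd.congr fun i => Data.ofNat_snd (n i)

theorem xor {b c : ι → Bool} (h : PolyTime E fun i => ofBool (b i))
    (h' : PolyTime E fun i => ofBool (c i)) : PolyTime E fun i => ofBool (b i ^^ c i) :=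
  ((h.and h'.not).or (h.not.and h')).congr fun i => by cases b i <;> cases c i <;> rfl

theorem nat_foldl_bit {l : ι → List Bool} {n : ι → ℕ}
    (hl : PolyTime E fun i => ofList ((l i).map ofBool)) (hn : PolyTime E fun i => ofNat (n i)) :
    PolyTime E fun i => ofNat ((l i).foldl (fun v b => Nat.bit b v) (n i)) := by
  refine foldl_of_prefix (β := fun _ => Bool) (σ := fun _ => ℕ) (eβ := fun _ => ofBool)
    (eσ := fun _ => ofNat) (L := l) (step := fun _ v b => Nat.bit b v) hl hn ?_ ?_
  · refine (((((PolyBound.const 4 _).mul (hl.size.add hn.size)).add (.const 1 _))).reindex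
      Sigma.fst).mono_left fun x => (Data.size_ofNat_le _).trans ?_
    have key : ∀ (l : List Bool) (v : ℕ),
        (l.foldl (fun v b => Nat.bit b v) v).size ≤ l.length + v.size := by
      intro l
      induction l with
      | nil => simp
      | cons b l ih =>
        intro v
        refine (ih _).trans ?_
        have : (Nat.bit b v).size ≤ v.size + 1 := by
          rw [Nat.size_le, Nat.bit_val, pow_succ]
          have := Nat.lt_size_self v
          cases b <;> simp <;> omega
        simp only [List.length_cons]
        omega
    have h1 := key ((l x.1).take x.2) (n x.1)
    have h2 := Data.nat_size_le (n x.1)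
    have h3 := Data.length_le_size_ofList ((l x.1).map ofBool)
    rw [List.length_map] at h3
    rw [List.length_take] at h1
    omega
  · exact nat_bit (id _).snd.snd (id _).snd.fst

/-- A list at least as long as the binary expansions of two numbers. -/
theorem padding {a b : ι → ℕ} (ha : PolyTime E fun i => ofNat (a i))
    (hb : PolyTime E fun i => ofNat (b i)) :
    PolyTime E fun i => ofList (((a i).bits ++ (b i).bits).map ofBool) :=
  (append (L := fun i => (a i).bits.map ofBool) (L' := fun i => (b i).bits.map ofBool) ha hb).congr
    fun i => by rw [List.map_append]

theorem nat_add {a b : ι → ℕ} (ha : PolyTime E fun i => ofNat (a i))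
    (hb : PolyTime E fun i => ofNat (b i)) : PolyTime E fun i => ofNat (a i + b i) := by
  let e : ℕ × ℕ × Bool × List Bool → Data := fun s =>
    .cons (ofNat s.1) (.cons (ofNat s.2.1) (.cons (ofBool s.2.2.1) (ofList (s.2.2.2.map ofBool))))
  have hpad := padding ha hb
  have := foldl_of_prefix (β := fun _ => Bool) (σ := fun _ => ℕ × ℕ × Bool × List Bool)
    (eβ := fun _ => ofBool) (eσ := fun _ => e) (L := fun i => (a i).bits ++ (b i).bits)
    (s₀ := fun i => (a i, b i, false, [])) (step := fun _ s _ => addStep s) hpad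
    (ha.pair (hb.pair ((const E (ofBool false)).pair (nil E)))) ?_ ?_
  · have hf := nat_foldl_bit this.snd.snd.snd
      (nat_bit this.snd.snd.fst (const E (ofNat 0)))
    refine hf.congr fun i => ?_
    rw [show ∀ c, Nat.bit c 0 = c.toNat from fun c => by cases c <;> rfl, foldl_addStep]
    · simp
    · refine (Nat.lt_size_self _).trans_le (Nat.pow_le_pow_right (by norm_num) ?_)
      simp [Nat.size_eq_bits_len]
    · refine (Nat.lt_size_self _).trans_le (Nat.pow_le_pow_right (by norm_num) ?_)
      simp [Nat.size_eq_bits_len]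
  · refine (((((PolyBound.const 4 _).mul (ha.size.add hb.size)).add
      (hpad.size.mul (.const 4 _))).add (.const 13 _)).reindex Sigma.fst).mono_left fun x => ?_
    obtain ⟨h1, h2, h3⟩ := length_foldl_addStep
      (((a x.1).bits ++ (b x.1).bits).take x.2) (a x.1, b x.1, false, [])
    set s := (((a x.1).bits ++ (b x.1).bits).take x.2).foldl (fun s _ => addStep s)
      (a x.1, b x.1, false, [])
    have h4 := Data.size_ofNat_mono h2
    have h5 := Data.size_ofNat_mono h3
    have h6 : (ofBool s.2.2.1).size ≤ 3 := by cases s.2.2.1 <;> simp [ofBool, Data.size]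
    have h7 := Data.length_le_size_ofList (((a x.1).bits ++ (b x.1).bits).map ofBool)
    have h8 := Data.size_ofList_le (l := s.2.2.2.map ofBool) (n := s.2.2.2.length) (s := 3)
      (by simp) fun d hd => by
        obtain ⟨b, _, rfl⟩ := List.mem_map.1 hd
        cases b <;> simp [ofBool, Data.size]
    rw [List.length_map] at h7
    rw [List.length_take] at h1
    simp only [List.length_nil] at h1
    simp only [e, Data.size]
    simp only at h4 h5
    omega
  · have hid := id (fun x : Σ i, {j // j < ((a i).bits ++ (b i).bits).length} =>
      Data.cons (E x.1) (.cons (e ((((a x.1).bits ++ (b x.1).bits).take x.2).foldl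
        (fun s _ => addStep s) (a x.1, b x.1, false, [])))
        (ofBool ((((a x.1).bits ++ (b x.1).bits))[x.2.1]'x.2.2))))
    have hx := hid.snd.fst.fst
    have hy := hid.snd.fst.snd.fst
    have hc := hid.snd.fst.snd.snd.fst
    have hl := hid.snd.fst.snd.snd.snd
    exact hx.nat_div2.pair (hy.nat_div2.pair (((hx.nat_bodd.and hy.nat_bodd).or
      (hc.and (hx.nat_bodd.or hy.nat_bodd))).pair (((hx.nat_bodd.xor hy.nat_bodd).xor hc).pair hl)))

theorem nat_le {a b : ι → ℕ} (ha : PolyTime E fun i => ofNat (a i))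
    (hb : PolyTime E fun i => ofNat (b i)) :
    PolyTime E fun i => ofBool (decide (a i ≤ b i)) := by
  let e : ℕ × ℕ × Bool → Data := fun s =>
    .cons (ofNat s.1) (.cons (ofNat s.2.1) (ofBool s.2.2))
  have hpad := padding ha hb
  have := foldl_of_prefix (β := fun _ => Bool) (σ := fun _ => ℕ × ℕ × Bool)
    (eβ := fun _ => ofBool) (eσ := fun _ => e) (L := fun i => (a i).bits ++ (b i).bits)
    (s₀ := fun i => (a i, b i, true)) (step := fun _ s _ => leStep s) hpad
    (ha.pair (hb.pair (const E (ofBool true)))) ?_ ?_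
  · refine this.snd.snd.congr fun i => ?_
    rw [foldl_leStep]
    · congr 1
      simp only [and_true, decide_eq_decide]
      exact le_iff_lt_or_eq.symm
    · refine (Nat.lt_size_self _).trans_le (Nat.pow_le_pow_right (by norm_num) ?_)
      simp [Nat.size_eq_bits_len]
    · refine (Nat.lt_size_self _).trans_le (Nat.pow_le_pow_right (by norm_num) ?_)
      simp [Nat.size_eq_bits_len]
  · refine ((((PolyBound.const 4 _).mul (ha.size.add hb.size)).add
      (.const 10 _)).reindex Sigma.fst).mono_left fun x => ?_
    obtain ⟨h2, h3⟩ := foldl_leStep_le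
      (((a x.1).bits ++ (b x.1).bits).take x.2) (a x.1, b x.1, true)
    set s := (((a x.1).bits ++ (b x.1).bits).take x.2).foldl (fun s _ => leStep s)
      (a x.1, b x.1, true)
    have h4 := Data.size_ofNat_mono h2
    have h5 := Data.size_ofNat_mono h3
    have h6 : (ofBool s.2.2).size ≤ 3 := by cases s.2.2 <;> simp [ofBool, Data.size]
    simp only [e, Data.size]
    simp only at h4 h5
    omega
  · have hid := id (fun x : Σ i, {j // j < ((a i).bits ++ (b i).bits).length} =>
      Data.cons (E x.1) (.cons (e ((((a x.1).bits ++ (b x.1).bits).take x.2).foldl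
        (fun s _ => leStep s) (a x.1, b x.1, true)))
        (ofBool ((((a x.1).bits ++ (b x.1).bits))[x.2.1]'x.2.2))))
    have hx := hid.snd.fst.fst
    have hy := hid.snd.fst.snd.fst
    have hc := hid.snd.fst.snd.snd
    exact hx.nat_div2.pair (hy.nat_div2.pair (((hx.nat_bodd.not.and hy.nat_bodd).or
      (hc.and (hx.nat_bodd.not.or hy.nat_bodd)))))

theorem nat_eq {a b : ι → ℕ} (ha : PolyTime E fun i => ofNat (a i))
    (hb : PolyTime E fun i => ofNat (b i)) : PolyTime E fun i => ofBool (decide (a i = b i)) :=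
  ((nat_le ha hb).and (nat_le hb ha)).congr fun i => by
    rw [← Bool.decide_and, decide_eq_decide.2 le_antisymm_iff.symm]

theorem nat_lt {a b : ι → ℕ} (ha : PolyTime E fun i => ofNat (a i))
    (hb : PolyTime E fun i => ofNat (b i)) : PolyTime E fun i => ofBool (decide (a i < b i)) :=
  (nat_le hb ha).not.congr fun i => by rw [← decide_not, decide_eq_decide.2 not_le]

theorem nat_mul {a b : ι → ℕ} (ha : PolyTime E fun i => ofNat (a i))
    (hb : PolyTime E fun i => ofNat (b i)) : PolyTime E fun i => ofNat (a i * b i) := by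
  have hL : PolyTime E fun i => ofList ((b i).bits.reverse.map ofBool) :=
    (reverse (L := fun i => (b i).bits.map ofBool) hb).congr fun i => by rw [List.map_reverse]
  have := foldl_of_prefix (β := fun _ => Bool) (σ := fun _ => ℕ)
    (eβ := fun _ => ofBool) (eσ := fun _ => ofNat) (L := fun i => (b i).bits.reverse)
    (s₀ := fun _ => 0) (step := fun i v c => v + v + if c then a i else 0) hL (const E (ofNat 0))
    ?_ ?_
  · exact this.congr fun i => by rw [List.foldl_reverse, foldr_bits_mul]
  · refine ((((PolyBound.const 4 _).mul (ha.size.add hb.size)).add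
      (.const 1 _)).reindex Sigma.fst).mono_left fun x => (Data.size_ofNat_le _).trans ?_
    have h1 := foldl_mul_le (a x.1) ((b x.1).bits.reverse.take x.2) 0
    set v := ((b x.1).bits.reverse.take x.2).foldl (fun v c => v + v + if c then a x.1 else 0) 0
    have h2 : v.size ≤ (a x.1).size + (b x.1).size := by
      rw [Nat.size_le]
      have h3 : ((b x.1).bits.reverse.take x.2).length ≤ (b x.1).size := by
        exact (List.length_take_le' _ _).trans (by simp [Nat.size_eq_bits_len])
      have h4 := Nat.lt_size_self (a x.1)
      have h5 : v ≤ a x.1 * 2 ^ ((b x.1).bits.reverse.take x.2).length := by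
        rw [zero_add] at h1; omega
      rw [pow_add]
      calc v ≤ a x.1 * 2 ^ (b x.1).size :=
            h5.trans (Nat.mul_le_mul_left _ (Nat.pow_le_pow_right (by norm_num) h3))
        _ < _ := Nat.mul_lt_mul_of_pos_right h4 (by positivity)
    have := Data.nat_size_le (a x.1)
    have := Data.nat_size_le (b x.1)
    omega
  · have hid := id (fun x : Σ i, {j // j < (b i).bits.reverse.length} =>
      Data.cons (E x.1) (.cons (ofNat (((b x.1).bits.reverse.take x.2).foldl
        (fun v c => v + v + if c then a x.1 else 0) 0))
        (ofBool ((b x.1).bits.reverse[x.2.1]'x.2.2))))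
    have hv := hid.snd.fst
    refine (hv.nat_add hv).nat_add ((ite
      (p := fun x : Σ i, {j // j < (b i).bits.reverse.length} =>
        (b x.1).bits.reverse[x.2.1]'x.2.2 = true)
      (hid.snd.snd.congr fun i => by rw [Bool.decide_eq_true])
      (hid.fst.comp (ha.reindex fun x : Σ i, {j // j < (b i).bits.reverse.length} => x.1))
      (const _ (ofNat 0))).congr fun x => ?_)
    split_ifs <;> rfl

end PolyTime

/-! ## Distances in trees -/

theorem dist_add_dist_of_mem_support {V : Type} {G : SimpleGraph V} {a b x : V} (p : G.Walk a b)
    (hp : p.length = G.dist a b) (hx : x ∈ p.support) (hG : G.Connected) :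
    G.dist a b = G.dist a x + G.dist x b := by
  classical
  have h1 := p.take_spec hx
  have h2 : (p.takeUntil x hx).length + (p.dropUntil x hx).length = p.length := by
    rw [← SimpleGraph.Walk.length_append, h1]
  have h3 := SimpleGraph.dist_le (p.takeUntil x hx)
  have h4 := SimpleGraph.dist_le (p.dropUntil x hx)
  have h5 := hG.dist_triangle (u := a) (v := x) (w := b)
  omega

/-- An edge of a tree separates the vertices closer to one end from those closer to the other. -/
theorem dist_eq_add_of_separated {V : Type} {G : SimpleGraph V} (hG : G.IsTree) {r u q v : V}
    (hqv : G.Adj q v) (hr : G.dist r v = G.dist r q + 1) (hu : G.dist u q = G.dist u v + 1) :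
    G.dist r u = G.dist r v + G.dist v u := by
  have hc := hG.connected
  obtain ⟨A, hA⟩ := hc.exists_walk_length_eq_dist r q
  obtain ⟨W, hW⟩ := hc.exists_walk_length_eq_dist r u
  obtain ⟨B, hB⟩ := hc.exists_walk_length_eq_dist u v
  -- The edge is a bridge, so the closed detour from `q` via `r` and `u` to `v` along geodesics must
  -- use it. On the geodesic from `r` to `q` this contradicts `hr`, on that from `u` to `v` it
  -- contradicts `hu`; hence `v` lies on the geodesic from `r` to `u`.
  have hb := SimpleGraph.isBridge_iff_forall_walk_mem_edges.1
    (SimpleGraph.isAcyclic_iff_forall_adj_isBridge.1 hG.isAcyclic hqv)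
    (A.reverse.append (W.append B))
  simp only [SimpleGraph.Walk.edges_append, SimpleGraph.Walk.edges_reverse, List.mem_append,
    List.mem_reverse] at hb
  rcases hb with h | h | h
  · have := dist_add_dist_of_mem_support A hA (A.snd_mem_support_of_mem_edges h) hc
    omega
  · exact dist_add_dist_of_mem_support W hW (W.snd_mem_support_of_mem_edges h) hc
  · have := dist_add_dist_of_mem_support B hB (B.fst_mem_support_of_mem_edges h) hc
    omega

theorem exists_adj_dist {V : Type} {G : SimpleGraph V} (hG : G.Connected) {r v : V} (h : r ≠ v) :
    ∃ q, G.Adj q v ∧ G.dist r v = G.dist r q + 1 := by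
  obtain ⟨W, hW⟩ := hG.exists_walk_length_eq_dist v r
  cases W with
  | nil => exact absurd rfl h
  | @cons _ q _ hadj W' =>
    refine ⟨q, hadj.symm, ?_⟩
    have h1 := SimpleGraph.dist_le W'
    have h2 := hG.dist_triangle (u := v) (v := q) (w := r)
    rw [SimpleGraph.dist_eq_one_iff_adj.2 hadj] at h2
    rw [SimpleGraph.Walk.length_cons] at hW
    rw [SimpleGraph.dist_comm (u := r) (v := v), SimpleGraph.dist_comm (u := r) (v := q)]
    omega

/-! ## Elimination of voters -/

namespace Profile

variable {P : Profile}

instance (v : Fin P.n) (a b : Fin P.m) : Decidable (P.Prefers v a b) :=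
  inferInstanceAs (Decidable (P.pos v a < P.pos v b))

instance (i j k : Fin P.n) : Decidable (P.Between i j k) :=
  inferInstanceAs (Decidable (∀ a b : Fin P.m, P.Prefers i a b → P.Prefers k a b → P.Prefers j a b))

theorem prefers_trichotomy (v : Fin P.n) {a b : Fin P.m} (h : a ≠ b) :
    P.Prefers v a b ∨ P.Prefers v b a :=
  lt_or_gt_of_ne fun h' => h ((P.rank v).symm.injective h')

theorem Prefers.asymm {v : Fin P.n} {a b : Fin P.m} (h : P.Prefers v a b) : ¬ P.Prefers v b a :=
  lt_asymm h

theorem Prefers.ne {v : Fin P.n} {a b : Fin P.m} (h : P.Prefers v a b) : a ≠ b := by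
  rintro rfl; exact lt_irrefl _ h

/-- Two voters have the same order. -/
def Same (P : Profile) (u v : Fin P.n) : Prop := ∀ a b, P.Prefers u a b ↔ P.Prefers v a b

theorem Same.refl (u : Fin P.n) : P.Same u u := fun _ _ => Iff.rfl

theorem Same.symm {u v : Fin P.n} (h : P.Same u v) : P.Same v u := fun a b => (h a b).symm

theorem Same.trans {u v w : Fin P.n} (h : P.Same u v) (h' : P.Same v w) : P.Same u w :=
  fun a b => (h a b).trans (h' a b)

theorem Between.congr {i j k i' j' k' : Fin P.n} (h : P.Between i j k) (hi : P.Same i i')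
    (hj : P.Same j j') (hk : P.Same k k') : P.Between i' j' k' :=
  fun a b h1 h2 => (hj a b).1 (h a b ((hi a b).2 h1) ((hk a b).2 h2))

/-- The orders that occur in `S` are those of a subtree of `T`. -/
def TreeClosed (P : Profile) (T : SimpleGraph (Fin P.n)) (S : Finset (Fin P.n)) : Prop :=
  ∀ u w, (∃ s ∈ S, P.Same u s) → (∃ s ∈ S, P.Same w s) →
    ∀ j, T.dist u w = T.dist u j + T.dist j w → ∃ s ∈ S, P.Same j s

/-- `p` lies between `v` and every other member of `S`. -/
def IsGate (P : Profile) (S : Finset (Fin P.n)) (v p : Fin P.n) : Prop :=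
  v ≠ p ∧ ∀ u ∈ S, u ≠ v → P.Between u p v

/-- Let `v` prefer `a` to `b`. If `s` or `s'` agrees, so does `p`, which lies between that voter and
`v`. If neither does, both prefer `b` to `a`, and so would `v`, lying between them. -/
theorem same_of_between {s s' v p : Fin P.n} (h : P.Between s p v) (h' : P.Between s' p v)
    (hv : P.Between s v s') : P.Same v p := by
  have key : ∀ a b, P.Prefers v a b → P.Prefers p a b := by
    intro a b hab
    by_cases h1 : P.Prefers s a b
    · exact h a b h1 hab
    · by_cases h2 : P.Prefers s' a b
      · exact h' a b h2 hab
      · exact absurd hab (hv b a ((prefers_trichotomy s hab.ne).resolve_left h1)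
          ((prefers_trichotomy s' hab.ne).resolve_left h2)).asymm
  exact fun a b => ⟨key a b, fun hab => (prefers_trichotomy v hab.ne).resolve_right
    fun h => hab.asymm (key b a h)⟩

/-- Only the order of `v` can get lost. If a path between two remaining orders meets it, then `v`
lies between two other members of `S`, and the gate has the same order and stays. -/
theorem TreeClosed.erase {T : SimpleGraph (Fin P.n)} (hT : P.IntermediateOn T)
    {S : Finset (Fin P.n)} (hS : P.TreeClosed T S) {v p : Fin P.n} (hp : p ∈ S)
    (hg : P.IsGate S v p) : P.TreeClosed T (S.erase v) := by
  rintro u w ⟨s, hs, hus⟩ ⟨s', hs', hws⟩ j hj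
  obtain ⟨hsv, hsS⟩ := Finset.mem_erase.1 hs
  obtain ⟨hsv', hsS'⟩ := Finset.mem_erase.1 hs'
  obtain ⟨t, ht, hjt⟩ := hS u w ⟨s, hsS, hus⟩ ⟨s', hsS', hws⟩ j hj
  by_cases htv : t = v
  · subst htv
    refine ⟨p, Finset.mem_erase.2 ⟨hg.1.symm, hp⟩, hjt.trans ?_⟩
    exact same_of_between (hg.2 s hsS hsv) (hg.2 s' hsS' hsv') ((hT _ _ _ hj).congr hus hjt hws)
  · exact ⟨t, Finset.mem_erase.2 ⟨htv, ht⟩, hjt⟩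

/-- The analogue of taking a leaf of a rooted tree. Vertices of `T` whose voters have already been
removed may still carry orders of `S`, so the argument works with orders rather than with members of
`S`. -/
theorem TreeClosed.exists_isGate {T : SimpleGraph (Fin P.n)} (hTree : T.IsTree)
    (hT : P.IntermediateOn T) {S : Finset (Fin P.n)} (hS : P.TreeClosed T S) (h2 : 1 < S.card) :
    ∃ v ∈ S, ∃ p ∈ S, P.IsGate S v p := by
  classical
  by_cases hdup : ∃ v ∈ S, ∃ p ∈ S, v ≠ p ∧ P.Same v p
  · obtain ⟨v, hv, p, hp, hne, hsame⟩ := hdup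
    exact ⟨v, hv, p, hp, hne, fun u _ _ a b _ h => (hsame a b).1 h⟩
  have hinj : ∀ v ∈ S, ∀ p ∈ S, P.Same v p → v = p := by
    intro v hv p hp h
    by_contra hne
    exact hdup ⟨v, hv, p, hp, hne, h⟩
  obtain ⟨x, hx, y, hy, hxy⟩ := Finset.one_lt_card.1 h2
  let D := T.dist x
  -- For every order occurring in `S`, the vertices carrying it that are nearest to the root `x`;
  -- they need not belong to `S`.
  let M : Finset (Fin P.n) := Finset.univ.filter fun z =>
    (∃ s ∈ S, P.Same z s) ∧ ∀ y, P.Same y z → D z ≤ D y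
  have hM : ∀ s ∈ S, ∃ z ∈ M, P.Same z s := by
    intro s hs
    obtain ⟨z, hz, hmin⟩ := (Finset.univ.filter fun z => P.Same z s).exists_min_image D
      ⟨s, by simpa using Same.refl s⟩
    simp only [Finset.mem_filter, Finset.mem_univ, true_and] at hz hmin
    exact ⟨z, by simpa [M] using ⟨⟨s, hs, hz⟩, fun y hy => hmin y (hy.trans hz)⟩, hz⟩
  obtain ⟨z, hzM, hzy⟩ := hM y hy
  obtain ⟨v, hvM, hmax⟩ := M.exists_max_image D ⟨z, hzM⟩
  have hzx : z ≠ x := by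
    rintro rfl
    exact hxy (hinj z hx y hy hzy)
  have hDz : 0 < D z := hTree.connected.pos_dist_of_ne hzx.symm
  have hxv : x ≠ v := by
    rintro rfl
    have := hmax z hzM
    simp only [D, SimpleGraph.dist_self] at this hDz
    omega
  obtain ⟨q, hqv, hDq⟩ := exists_adj_dist hTree.connected hxv
  have hvM' := hvM
  simp only [M, Finset.mem_filter, Finset.mem_univ, true_and] at hvM'
  obtain ⟨⟨v', hv', hvv'⟩, hvmin⟩ := hvM'
  obtain ⟨p, hp, hqp⟩ := hS x v ⟨x, hx, Same.refl x⟩ ⟨v', hv', hvv'⟩ q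
    (by rw [SimpleGraph.dist_eq_one_iff_adj.2 hqv, hDq])
  refine ⟨v', hv', p, hp, ?_, fun u hu huv => ?_⟩
  -- If `p` were the voter `v'` itself, `q` would carry the order of `v` nearer to the root, against
  -- the choice of `v`.
  · rintro rfl
    have := hvmin q (hqp.trans hvv'.symm)
    simp only [D] at this
    omega
  · obtain ⟨w, hwM, hwu⟩ := hM u hu
    have hwv : w ≠ v := by
      rintro rfl
      exact huv (hinj u hu v' hv' (hwu.symm.trans hvv'))
    refine Between.congr (hT w q v ?_) hwu hqp hvv'
    rw [SimpleGraph.dist_eq_one_iff_adj.2 hqv]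
    -- If `w` were on the far side of the edge, `v` would lie on the path from `x` to `w`, and `w`
    -- would be farther from the root than the farthest vertex of `M`.
    refine (hTree.dist_eq_dist_add_one_of_adj w hqv.symm).resolve_right fun h => ?_
    have h1 := dist_eq_add_of_separated hTree hqv hDq h
    have h2 := hmax w hwM
    have h3 := hTree.connected.pos_dist_of_ne hwv.symm
    simp only [D] at h2
    omega

theorem treeClosed_univ (T : SimpleGraph (Fin P.n)) : P.TreeClosed T Finset.univ :=
  fun _ _ _ _ j _ => ⟨j, Finset.mem_univ j, Same.refl j⟩

end Profile

/-! ## The dynamic program -/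

/-- A partial solution: the representative of the voter at which it is stored, the number of edges
whose ends have different representatives, the assignment, and its cost as a fraction. -/
structure Cand (P : Profile) where
  lab : Fin P.m
  cuts : ℕ
  wit : List (Fin P.n × Fin P.m)
  cost : ℕ × ℕ

/-- Comparison of fractions. -/
def FracLt (x y : ℕ × ℕ) : Prop := x.1 * y.2 < y.1 * x.2

instance (x y : ℕ × ℕ) : Decidable (FracLt x y) := inferInstanceAs (Decidable (_ < _))

/-- Addition or maximum of fractions. -/
def fracOp (ver : Version) (x y : ℕ × ℕ) : ℕ × ℕ :=
  match ver with
  | .utilitarian => (x.1 * y.2 + y.1 * x.2, x.2 * y.2)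
  | .egalitarian => if FracLt x y then y else x

section

variable {P : Profile}

/-- Attach the subtree of a child to that of its parent. -/
def Cand.join (ver : Version) (c d : Cand P) : Cand P where
  lab := c.lab
  cuts := c.cuts + (d.cuts + if c.lab = d.lab then 0 else 1)
  wit := c.wit ++ d.wit
  cost := fracOp ver c.cost d.cost

/-- A cheapest candidate, as a list of length at most one. -/
def best (l : List (Cand P)) : List (Cand P) :=
  l.foldl (fun acc c => if acc.all fun d => decide (FracLt c.cost d.cost) then [c] else acc) []

/-- The cheapest candidates for all representatives and all numbers of cuts. -/
def prune (p : Fin P.n) (l : List (Cand P)) : List (Cand P) :=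
  (List.ofFn (P.rank p)).flatMap fun a => (List.finRange P.n).flatMap fun j =>
    best (l.filter fun c => decide (c.lab = a) && decide (c.cuts = j.val))

/-- The voters not yet eliminated, and their tables of candidates. -/
abbrev DPState (P : Profile) : Type := List (Fin P.n) × (Fin P.n → List (Cand P))

/-- The table of `p` after its child `v` has been attached. -/
def mergeTable (ver : Version) (F : Fin P.n → List (Cand P)) (v p : Fin P.n) : List (Cand P) :=
  prune p ((F p).flatMap fun c => (F v).map fun d => c.join ver d)

/-- Being a gate depends on the orders alone, so it can be tested without knowing the tree. -/
def gatePairs (S : List (Fin P.n)) : List (Fin P.n × Fin P.n) :=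
  (S.flatMap fun v => S.map fun p => (v, p)).filter fun x =>
    !decide (x.1 = x.2) && S.all fun u => decide (u = x.1) || decide (P.Between u x.2 x.1)

/-- Eliminate one voter. -/
def dpStep (ver : Version) (s : DPState P) : DPState P :=
  match gatePairs s.1 with
  | [] => s
  | (v, p) :: _ => (s.1.filter fun u => !decide (u = v),
      fun u => if u = p then mergeTable ver s.2 v p else s.2 u)

def dpInit (ρ : Fin P.n → Fin P.m → ℚ≥0) : DPState P :=
  (List.finRange P.n, fun v => (List.ofFn (P.rank v)).map fun a =>
    ⟨a, 0, [(v, a)], ((ρ v a).num, (ρ v a).den)⟩)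

/-- The voters only count the rounds. On the profiles considered, each round removes a voter while
two are left, and a single voter has no gate, so superfluous rounds change nothing. -/
def dpRun (ver : Version) (ρ : Fin P.n → Fin P.m → ℚ≥0) : DPState P :=
  (List.finRange P.n).foldl (fun s _ => dpStep ver s) (dpInit ρ)

/-- Fewer than `k` cuts means at most `k` alternatives. -/
def dpResult (ver : Version) (ρ : Fin P.n → Fin P.m → ℚ≥0) (k : ℕ) : List (Cand P) :=
  best (((dpRun ver ρ).1.flatMap (dpRun ver ρ).2).filter fun c => decide (c.cuts < k))

end

/-! ## Costs -/

def fracVal (x : ℕ × ℕ) : ℚ≥0 := x.1 / x.2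

def costOp (ver : Version) (x y : ℚ≥0) : ℚ≥0 :=
  match ver with
  | .utilitarian => x + y
  | .egalitarian => max x y

/-- Sum or maximum over a finite set. -/
def agg {V : Type} (ver : Version) (S : Finset V) (f : V → ℚ≥0) : ℚ≥0 :=
  match ver with
  | .utilitarian => ∑ v ∈ S, f v
  | .egalitarian => S.sup f

theorem fracLt_iff {x y : ℕ × ℕ} (hx : 0 < x.2) (hy : 0 < y.2) :
    FracLt x y ↔ fracVal x < fracVal y := by
  rw [FracLt, fracVal, fracVal, div_lt_div_iff₀ (by exact_mod_cast hx) (by exact_mod_cast hy)]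
  norm_cast

theorem fracOp_pos (ver : Version) {x y : ℕ × ℕ} (hx : 0 < x.2) (hy : 0 < y.2) :
    0 < (fracOp ver x y).2 := by
  cases ver with
  | utilitarian => exact Nat.mul_pos hx hy
  | egalitarian => simp only [fracOp]; split_ifs <;> assumption

theorem fracVal_fracOp (ver : Version) {x y : ℕ × ℕ} (hx : 0 < x.2) (hy : 0 < y.2) :
    fracVal (fracOp ver x y) = costOp ver (fracVal x) (fracVal y) := by
  cases ver with
  | utilitarian =>
    have h1 : (x.2 : ℚ≥0) ≠ 0 := by exact_mod_cast hx.ne'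
    have h2 : (y.2 : ℚ≥0) ≠ 0 := by exact_mod_cast hy.ne'
    simp only [fracOp, costOp, fracVal]
    push_cast
    field_simp
  | egalitarian =>
    simp only [fracOp, costOp]
    split_ifs with h
    · exact (max_eq_right ((fracLt_iff hx hy).1 h).le).symm
    · exact (max_eq_left (not_lt.1 fun h' => h ((fracLt_iff hx hy).2 h'))).symm

/-- The factor 2 leaves room for the sum in the numerator: both products are at most a quarter of `2
^ (a + b)`. Exponents thus add, and unreduced fractions stay of polynomial bit length however the
subtrees are joined. -/
theorem fracOp_le (ver : Version) {x y : ℕ × ℕ} {a b : ℕ} (h1 : 2 * x.1 ≤ 2 ^ a)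
    (h2 : 2 * x.2 ≤ 2 ^ a) (h3 : 2 * y.1 ≤ 2 ^ b) (h4 : 2 * y.2 ≤ 2 ^ b) :
    2 * (fracOp ver x y).1 ≤ 2 ^ (a + b) ∧ 2 * (fracOp ver x y).2 ≤ 2 ^ (a + b) := by
  cases ver with
  | utilitarian =>
    have e1 := Nat.mul_le_mul h1 h4
    have e2 := Nat.mul_le_mul h3 h2
    have e3 := Nat.mul_le_mul h2 h4
    rw [← pow_add] at e1 e2 e3
    rw [add_comm b a] at e2
    simp only [fracOp]
    constructor <;> nlinarith
  | egalitarian =>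
    have := Nat.pow_le_pow_right (n := 2) (by norm_num) (Nat.le_add_right a b)
    have := Nat.pow_le_pow_right (n := 2) (by norm_num) (Nat.le_add_left b a)
    simp only [fracOp]
    split_ifs <;> omega

theorem costOp_assoc (ver : Version) (x y z : ℚ≥0) :
    costOp ver (costOp ver x y) z = costOp ver x (costOp ver y z) := by
  cases ver
  · exact add_assoc x y z
  · exact max_assoc x y z

theorem costOp_zero_left (ver : Version) (x : ℚ≥0) : costOp ver 0 x = x := by
  cases ver
  · exact zero_add x
  · exact max_eq_right zero_le

theorem costOp_mono (ver : Version) {x y x' y' : ℚ≥0} (hx : x ≤ x') (hy : y ≤ y') :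
    costOp ver x y ≤ costOp ver x' y' := by
  cases ver
  · exact add_le_add hx hy
  · exact max_le_max hx hy

section

variable {V : Type}

theorem agg_insert [DecidableEq V] (ver : Version) {S : Finset V} {v : V} (hv : v ∉ S) (f : V → ℚ≥0) :
    agg ver (insert v S) f = costOp ver (f v) (agg ver S f) := by
  cases ver
  · exact Finset.sum_insert hv
  · exact Finset.sup_insert

theorem agg_erase [DecidableEq V] (ver : Version) {S : Finset V} {v : V} (hv : v ∈ S) (f : V → ℚ≥0) :
    agg ver S f = costOp ver (f v) (agg ver (S.erase v) f) := by
  conv_lhs => rw [← Finset.insert_erase hv, agg_insert ver (Finset.notMem_erase v S)]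

theorem agg_congr (ver : Version) {S : Finset V} {f g : V → ℚ≥0} (h : ∀ v ∈ S, f v = g v) :
    agg ver S f = agg ver S g := by
  cases ver
  · exact Finset.sum_congr rfl h
  · exact Finset.sup_congr rfl h

theorem agg_mono (ver : Version) {S : Finset V} {f g : V → ℚ≥0} (h : ∀ v ∈ S, f v ≤ g v) :
    agg ver S f ≤ agg ver S g := by
  cases ver
  · exact Finset.sum_le_sum h
  · exact Finset.sup_mono_fun h

theorem agg_singleton (ver : Version) (v : V) (f : V → ℚ≥0) : agg ver {v} f = f v := by
  cases ver
  · exact Finset.sum_singleton f v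
  · exact Finset.sup_singleton

theorem total_eq_agg {n m : ℕ} (ver : Version) (ρ : Fin n → Fin m → ℚ≥0) (w : Fin n → Fin m) :
    total ver ρ w = agg ver Finset.univ fun v => ρ v (w v) := by
  cases ver <;> rfl

/-- The cost of a partial assignment. -/
def listCost {A : Type} (ver : Version) (ρ : V → A → ℚ≥0) (l : List (V × A)) : ℚ≥0 :=
  l.foldr (fun x c => costOp ver (ρ x.1 x.2) c) 0

theorem listCost_append {A : Type} (ver : Version) (ρ : V → A → ℚ≥0) (l l' : List (V × A)) :
    listCost ver ρ (l ++ l') = costOp ver (listCost ver ρ l) (listCost ver ρ l') := by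
  induction l with
  | nil => exact (costOp_zero_left _ _).symm
  | cons a l ih =>
    rw [List.cons_append]
    simp only [listCost, List.foldr_cons] at ih ⊢
    rw [ih, costOp_assoc]

theorem listCost_eq_agg [DecidableEq V] {A : Type} (ver : Version) (ρ : V → A → ℚ≥0)
    (w : V → A) {l : List (V × A)} (hw : ∀ x ∈ l, x.2 = w x.1) (hl : (l.map Prod.fst).Nodup) :
    listCost ver ρ l = agg ver (l.map Prod.fst).toFinset fun v => ρ v (w v) := by
  induction l with
  | nil => cases ver <;> rfl
  | cons a l ih =>
    rw [List.map_cons, List.nodup_cons] at hl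
    rw [List.map_cons, List.toFinset_cons, agg_insert ver (by simpa using hl.1),
      ← ih (fun x hx => hw x (by simp [hx])) hl.2, ← hw a (by simp)]
    rfl

end

/-! ## Cheapest candidates -/

section

variable {P : Profile}

theorem best_append_singleton (l : List (Cand P)) (c : Cand P) : best (l ++ [c]) =
    if (best l).all fun d => decide (FracLt c.cost d.cost) then [c] else best l := by
  rw [best, List.foldl_append]; rfl

theorem length_best_le (l : List (Cand P)) : (best l).length ≤ 1 := by
  induction l using List.reverseRecOn with
  | nil => simp [best]
  | append_singleton l c ih => rw [best_append_singleton]; split_ifs <;> simp [ih]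

theorem mem_of_mem_best {l : List (Cand P)} {c : Cand P} (h : c ∈ best l) : c ∈ l := by
  induction l using List.reverseRecOn with
  | nil => simp [best] at h
  | append_singleton l d ih =>
    rw [best_append_singleton] at h
    split_ifs at h
    · simp at h; simp [h]
    · simp [ih h]

theorem exists_best {l : List (Cand P)} (hpos : ∀ c ∈ l, 0 < c.cost.2) {c : Cand P} (h : c ∈ l) :
    ∃ d ∈ best l, fracVal d.cost ≤ fracVal c.cost := by
  induction l using List.reverseRecOn generalizing c with
  | nil => simp at h
  | append_singleton l d ih =>
    have hpos' : ∀ c ∈ l, 0 < c.cost.2 := fun c hc => hpos c (by simp [hc])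
    have hd := hpos d (by simp)
    rw [best_append_singleton]
    split_ifs with hall
    · refine ⟨d, by simp, ?_⟩
      simp only [List.mem_append, List.mem_singleton] at h
      rcases h with h | rfl
      · obtain ⟨e, he, hec⟩ := ih hpos' h
        have := List.all_eq_true.1 hall e he
        rw [decide_eq_true_eq, fracLt_iff hd (hpos' e (mem_of_mem_best he))] at this
        exact this.le.trans hec
      · exact le_rfl
    · simp only [List.mem_append, List.mem_singleton] at h
      rcases h with h | rfl
      · exact ih hpos' h
      · simp only [List.all_eq_true, not_forall, decide_eq_true_eq] at hall
        obtain ⟨e, he, hec⟩ := hall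
        rw [fracLt_iff hd (hpos' e (mem_of_mem_best he))] at hec
        exact ⟨e, he, not_lt.1 hec⟩

theorem mem_of_mem_prune {p : Fin P.n} {l : List (Cand P)} {c : Cand P} (h : c ∈ prune p l) :
    c ∈ l ∧ c.cuts < P.n := by
  simp only [prune, List.mem_flatMap] at h
  obtain ⟨a, _, j, _, h⟩ := h
  have h := mem_of_mem_best h
  simp only [List.mem_filter, Bool.and_eq_true, decide_eq_true_eq] at h
  exact ⟨h.1, h.2.2 ▸ j.2⟩

/-- A discarded candidate can always be replaced by a kept one: later steps see only label, number
of cuts and cost. -/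
theorem exists_mem_prune {p : Fin P.n} {l : List (Cand P)} (hpos : ∀ c ∈ l, 0 < c.cost.2)
    {c : Cand P} (h : c ∈ l) (hc : c.cuts < P.n) :
    ∃ d ∈ prune p l, d.lab = c.lab ∧ d.cuts = c.cuts ∧ fracVal d.cost ≤ fracVal c.cost := by
  obtain ⟨d, hd, hdc⟩ := exists_best
    (l := l.filter fun e => decide (e.lab = c.lab) && decide (e.cuts = (⟨c.cuts, hc⟩ : Fin P.n).val))
    (fun e he => hpos e (List.mem_of_mem_filter he)) (c := c) (by simp [h])
  refine ⟨d, ?_, ?_⟩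
  · simp only [prune, List.mem_flatMap]
    refine ⟨c.lab, ?_, ⟨c.cuts, hc⟩, List.mem_finRange _, hd⟩
    exact (List.mem_ofFn' _ _).2 ⟨(P.rank p).symm c.lab, by simp⟩
  · have h := mem_of_mem_best hd
    simp only [List.mem_filter, Bool.and_eq_true, decide_eq_true_eq] at h
    exact ⟨h.2.1, h.2.2, hdc⟩

theorem length_prune_le (p : Fin P.n) (l : List (Cand P)) :
    (prune p l).length ≤ P.m * P.n := by
  have key : ∀ {α β : Type} (f : α → List β) (b : ℕ) (l : List α), (∀ a ∈ l, (f a).length ≤ b) →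
      (l.flatMap f).length ≤ l.length * b := by
    intro α β f b l h
    rw [List.length_flatMap]
    simpa using List.sum_le_card_nsmul (l.map fun a => (f a).length) b (by simpa using h)
  have := key (fun a => (List.finRange P.n).flatMap fun j =>
    best (l.filter fun c => decide (c.lab = a) && decide (c.cuts = j.val))) P.n
    (List.ofFn (P.rank p)) fun a _ => by
      simpa using key (fun j : Fin P.n =>
        best (l.filter fun c => decide (c.lab = a) && decide (c.cuts = j.val))) 1
        (List.finRange P.n) fun j _ => length_best_le _
  simpa [prune] using this

end

/-! ## Correctness of the dynamic program -/

section

variable {P : Profile}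

/-- What every candidate satisfies; `B` bounds the bit lengths of the single costs. -/
structure Cand.Sound (ver : Version) (ρ : Fin P.n → Fin P.m → ℚ≥0) (B : ℕ) (c : Cand P) :
    Prop where
  pos : 0 < c.cost.2
  val : fracVal c.cost = listCost ver ρ c.wit
  card : (insert c.lab (c.wit.map Prod.snd).toFinset).card ≤ c.cuts + 1
  cuts : c.cuts < P.n
  num_le : 2 * c.cost.1 ≤ 2 ^ (B * c.wit.length)
  den_le : 2 * c.cost.2 ≤ 2 ^ (B * c.wit.length)

/-- The voters represented by one alternative form a convex set. -/
def ConvexAssignment (w : Fin P.n → Fin P.m) : Prop :=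
  ∀ u p v, P.Between u p v → w u = w v → w p = w u

/-- In `cluster`, `C v` collects the voters already attached to `v`; a multiset, so that the sum
states that the clusters partition all voters. `complete` is the optimality half: every convex
assignment `w` is matched by stored candidates that agree with it at the remaining voters, cost no
more in total, and whose cuts plus the alternatives `w` still uses at remaining voters do not exceed
all the alternatives used by `w`. `sound` and `length` give the converse estimates and the size
bound; `closed` guarantees the next gate. -/
structure DPInv (ver : Version) (ρ : Fin P.n → Fin P.m → ℚ≥0) (B : ℕ)
    (T : SimpleGraph (Fin P.n)) (s : DPState P) : Prop where
  nodup : s.1.Nodup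
  ne_nil : s.1 ≠ []
  closed : P.TreeClosed T s.1.toFinset
  cluster : ∃ C : Fin P.n → Multiset (Fin P.n),
    (∀ v ∈ s.1, ∀ c ∈ s.2 v, (c.wit.map Prod.fst : Multiset (Fin P.n)) = C v) ∧
    ∑ v ∈ s.1.toFinset, C v = Finset.univ.val
  sound : ∀ v ∈ s.1, ∀ c ∈ s.2 v, c.Sound ver ρ B
  length : ∀ v ∈ s.1, (s.2 v).length ≤ P.m * P.n
  complete : ∀ w : Fin P.n → Fin P.m, ConvexAssignment w →
    ∃ σ : Fin P.n → Cand P, (∀ v ∈ s.1, σ v ∈ s.2 v ∧ (σ v).lab = w v) ∧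
      agg ver s.1.toFinset (fun v => fracVal (σ v).cost) ≤ total ver ρ w ∧
      ∑ v ∈ s.1.toFinset, (σ v).cuts + (s.1.toFinset.image w).card ≤ (Finset.univ.image w).card

variable {ver : Version} {ρ : Fin P.n → Fin P.m → ℚ≥0} {B : ℕ} {T : SimpleGraph (Fin P.n)}

theorem Cand.Sound.join {c d : Cand P} (hc : c.Sound ver ρ B) (hd : d.Sound ver ρ B)
    (hcuts : (c.join ver d).cuts < P.n) : (c.join ver d).Sound ver ρ B where
  pos := fracOp_pos ver hc.pos hd.pos
  val := by
    rw [Cand.join, fracVal_fracOp ver hc.pos hd.pos, hc.val, hd.val, listCost_append]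
  card := by
    have h1 := hc.card
    have h2 := hd.card
    simp only [Cand.join, List.map_append, List.toFinset_append]
    have h3 : insert c.lab ((c.wit.map Prod.snd).toFinset ∪ (d.wit.map Prod.snd).toFinset) ⊆
        insert c.lab (c.wit.map Prod.snd).toFinset ∪ insert d.lab (d.wit.map Prod.snd).toFinset := by
      grind
    have h4 := Finset.card_le_card h3
    have h5 := Finset.card_union_add_card_inter (insert c.lab (c.wit.map Prod.snd).toFinset)
      (insert d.lab (d.wit.map Prod.snd).toFinset)
    -- With equal labels the two sets share an alternative, which saves one; with different labels
    -- the new cut pays for it.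
    split_ifs with h
    · have : 0 < (insert c.lab (c.wit.map Prod.snd).toFinset ∩
          insert d.lab (d.wit.map Prod.snd).toFinset).card :=
        Finset.card_pos.2 ⟨c.lab, by rw [h]; simp⟩
      omega
    · omega
  cuts := hcuts
  num_le := by
    simp only [Cand.join, List.length_append, mul_add]
    exact (fracOp_le ver hc.num_le hc.den_le hd.num_le hd.den_le).1
  den_le := by
    simp only [Cand.join, List.length_append, mul_add]
    exact (fracOp_le ver hc.num_le hc.den_le hd.num_le hd.den_le).2

theorem mem_gatePairs {S : List (Fin P.n)} {v p : Fin P.n} :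
    (v, p) ∈ gatePairs S ↔ v ∈ S ∧ p ∈ S ∧ P.IsGate S.toFinset v p := by
  simp only [gatePairs, List.mem_filter, List.mem_flatMap, List.mem_map, Prod.mk.injEq,
    Profile.IsGate, Bool.and_eq_true, Bool.not_eq_true', decide_eq_false_iff_not,
    List.all_eq_true, Bool.or_eq_true, decide_eq_true_eq, List.mem_toFinset]
  constructor
  · rintro ⟨⟨v', hv', p', hp', rfl, rfl⟩, hne, h⟩
    exact ⟨hv', hp', hne, fun u hu huv => (h u hu).resolve_left huv⟩
  · rintro ⟨hv, hp, hne, h⟩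
    exact ⟨⟨v, hv, p, hp, rfl, rfl⟩, hne, fun u hu => or_iff_not_imp_left.2 (h u hu)⟩

theorem dpStep_cases (ver : Version) (s : DPState P) :
    (gatePairs s.1 = [] ∧ dpStep ver s = s) ∨ ∃ v p, v ∈ s.1 ∧ p ∈ s.1 ∧
      P.IsGate s.1.toFinset v p ∧ dpStep ver s = (s.1.filter fun u => !decide (u = v),
        fun u => if u = p then mergeTable ver s.2 v p else s.2 u) := by
  rcases h : gatePairs s.1 with _ | ⟨⟨v, p⟩, l⟩
  · left; simp [dpStep, h]
  · right
    obtain ⟨h1, h2, h3⟩ := mem_gatePairs.1 (show (v, p) ∈ gatePairs s.1 by simp [h])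
    exact ⟨v, p, h1, h2, h3, by simp [dpStep, h]⟩

theorem toFinset_filter_ne (S : List (Fin P.n)) (v : Fin P.n) :
    (S.filter fun u => !decide (u = v)).toFinset = S.toFinset.erase v := by
  ext u; simp [and_comm]

theorem mem_mergeTable {F : Fin P.n → List (Cand P)} {v p : Fin P.n} {c : Cand P}
    (h : c ∈ mergeTable ver F v p) : c.cuts < P.n ∧ ∃ a ∈ F p, ∃ b ∈ F v, c = a.join ver b := by
  obtain ⟨h1, h2⟩ := mem_of_mem_prune h
  simp only [List.mem_flatMap, List.mem_map] at h1
  obtain ⟨a, ha, b, hb, rfl⟩ := h1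
  exact ⟨h2, a, ha, b, hb, rfl⟩

theorem DPInv.step {s : DPState P} (hT : P.IntermediateOn T) (h : DPInv ver ρ B T s) :
    DPInv ver ρ B T (dpStep ver s) := by
  rcases dpStep_cases ver s with ⟨_, hs⟩ | ⟨v, p, hv, hp, hg, hs⟩
  · rwa [hs]
  rw [hs]
  obtain ⟨S, F⟩ := s
  simp only at hv hp hg
  have hvS : v ∈ S.toFinset := List.mem_toFinset.2 hv
  have hpS : p ∈ S.toFinset := List.mem_toFinset.2 hp
  have hpv : p ∈ S.toFinset.erase v := Finset.mem_erase.2 ⟨hg.1.symm, hpS⟩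
  have memF : ∀ {u}, u ∈ S.filter (fun u => !decide (u = v)) ↔ u ∈ S ∧ u ≠ v := by simp
  have sound_merge : ∀ c ∈ mergeTable ver F v p, c.Sound ver ρ B := by
    intro c hc
    obtain ⟨h1, a, ha, b, hb, rfl⟩ := mem_mergeTable hc
    exact (h.sound p hp a ha).join (h.sound v hv b hb) h1
  refine ⟨h.nodup.filter _, ?_, ?_, ?_, ?_, ?_, ?_⟩
  · exact List.ne_nil_of_mem (memF.2 ⟨hp, hg.1.symm⟩)
  · simp only [toFinset_filter_ne]
    exact h.closed.erase hT hpS hg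
  · obtain ⟨C, hC, hsum⟩ := h.cluster
    refine ⟨fun u => if u = p then C p + C v else C u, fun u hu c hc => ?_, ?_⟩
    · simp only at hc ⊢
      split_ifs at hc ⊢ with hup
      · obtain ⟨h1, a, ha, b, hb, rfl⟩ := mem_mergeTable hc
        rw [← hC p hp a ha, ← hC v hv b hb]
        simp [Cand.join]
      · exact hC u (memF.1 hu).1 c hc
    · simp only [toFinset_filter_ne]
      rw [← hsum, ← Finset.add_sum_erase _ _ hvS, ← Finset.add_sum_erase _ _ hpv,
        ← Finset.add_sum_erase _ _ hpv, if_pos rfl]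
      rw [Finset.sum_congr rfl fun u hu => by rw [if_neg (Finset.ne_of_mem_erase hu)]]
      rw [add_comm (C p) (C v), add_assoc]
  · intro u hu c hc
    simp only at hc
    split_ifs at hc
    · exact sound_merge c hc
    · exact h.sound u (memF.1 hu).1 c hc
  · intro u hu
    simp only
    split_ifs
    · exact length_prune_le _ _
    · exact h.length u (memF.1 hu).1
  · intro w hw
    obtain ⟨σ, hσ, hcost, hcuts⟩ := h.complete w hw
    simp only at hσ hcost hcuts
    have hpos : ∀ c ∈ (F p).flatMap fun c => (F v).map fun d => c.join ver d, 0 < c.cost.2 := by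
      intro c hc
      simp only [List.mem_flatMap, List.mem_map] at hc
      obtain ⟨a, ha, b, hb, rfl⟩ := hc
      exact fracOp_pos ver (h.sound p hp a ha).pos (h.sound v hv b hb).pos
    have hmem : (σ p).join ver (σ v) ∈ (F p).flatMap fun c => (F v).map fun d => c.join ver d := by
      simp only [List.mem_flatMap, List.mem_map]
      exact ⟨σ p, (hσ p hp).1, σ v, (hσ v hv).1, rfl⟩
    -- This is where convexity enters. If `w p ≠ w v`, then removing `v` loses the alternative `w
    -- v`: a remaining `u` with `w u = w v` would force `w p = w u`, since `p` lies between `u` and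
    -- `v`. So the new cut is paid for.
    have himage : ((S.toFinset.erase v).image w).card + (if w p = w v then 0 else 1) ≤
        (S.toFinset.image w).card := by
      split_ifs with hpv
      · exact Finset.card_le_card (Finset.image_subset_image (Finset.erase_subset v S.toFinset))
      · rw [← Finset.insert_erase hvS, Finset.image_insert, Finset.erase_insert_eq_erase,
          Finset.erase_idem, Finset.card_insert_of_notMem]
        intro hmem
        obtain ⟨u, hu, huv⟩ := Finset.mem_image.1 hmem
        obtain ⟨huv', hu⟩ := Finset.mem_erase.1 hu
        exact hpv ((hw u p v (hg.2 u hu huv') huv).trans huv)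
    have hsum : ((σ p).join ver (σ v)).cuts + ∑ u ∈ (S.toFinset.erase v).erase p, (σ u).cuts +
        ((S.toFinset.erase v).image w).card ≤ (Finset.univ.image w).card := by
      rw [← Finset.add_sum_erase _ _ hvS, ← Finset.add_sum_erase _ _ hpv] at hcuts
      simp only [Cand.join, (hσ p hp).2, (hσ v hv).2]
      omega
    -- At most `n` alternatives are used, and at least one of them at a remaining voter, so the
    -- joined candidate falls in the range that pruning keeps.
    have hlt : ((σ p).join ver (σ v)).cuts < P.n := by
      have h1 : 0 < ((S.toFinset.erase v).image w).card :=
        Finset.card_pos.2 ⟨w p, Finset.mem_image_of_mem w hpv⟩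
      have h2 : (Finset.univ.image w).card ≤ P.n := by
        exact Finset.card_image_le.trans_eq (Finset.card_fin _)
      omega
    obtain ⟨d, hd, hlab, hdc, hdle⟩ := exists_mem_prune (p := p) hpos hmem hlt
    refine ⟨fun u => if u = p then d else σ u, fun u hu => ?_, ?_, ?_⟩
    · simp only
      split_ifs with hup
      · subst hup
        exact ⟨hd, hlab.trans (hσ u hp).2⟩
      · exact hσ u (memF.1 hu).1
    · simp only [toFinset_filter_ne]
      refine le_trans ?_ hcost
      rw [agg_erase ver hpv, agg_erase ver hvS, agg_erase ver hpv (fun u => fracVal (σ u).cost)]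
      simp only [if_true]
      rw [agg_congr ver (g := fun u => fracVal (σ u).cost)
        fun u hu => by rw [if_neg (Finset.ne_of_mem_erase hu)], ← costOp_assoc]
      refine costOp_mono ver (hdle.trans_eq ?_) le_rfl
      rw [Cand.join, fracVal_fracOp ver (h.sound p hp _ (hσ p hp).1).pos
        (h.sound v hv _ (hσ v hv).1).pos]
      -- The join puts `p` before `v`, the decomposition of the total puts `v` first.
      cases ver
      · exact add_comm _ _
      · exact max_comm _ _
    · simp only [toFinset_filter_ne]
      rw [← Finset.add_sum_erase _ _ hpv, if_pos rfl,
        Finset.sum_congr rfl fun u hu => by rw [if_neg (Finset.ne_of_mem_erase hu)], hdc]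
      exact hsum

theorem DPInv.length_step {s : DPState P} (hTree : T.IsTree) (hT : P.IntermediateOn T)
    (h : DPInv ver ρ B T s) : (dpStep ver s).1.length ≤ max 1 (s.1.length - 1) := by
  rcases dpStep_cases ver s with ⟨h0, hs⟩ | ⟨v, p, hv, hp, hg, hs⟩
  · rw [hs, le_max_iff]
    left
    by_contra hlen
    obtain ⟨v, hv, p, hp, hg⟩ := h.closed.exists_isGate hTree hT
      (by rw [List.toFinset_card_of_nodup h.nodup]; omega)
    have := mem_gatePairs.2 ⟨List.mem_toFinset.1 hv, List.mem_toFinset.1 hp, hg⟩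
    rw [h0] at this
    simp at this
  · rw [hs, ← List.toFinset_card_of_nodup (h.nodup.filter _), toFinset_filter_ne,
      Finset.card_erase_of_mem (List.mem_toFinset.2 hv), List.toFinset_card_of_nodup h.nodup]
    exact le_max_right _ _

theorem dpInv_init (hTree : T.IsTree) (hB : ∀ v a, 2 * (ρ v a).num ≤ 2 ^ B ∧ 2 * (ρ v a).den ≤ 2 ^ B) :
    DPInv ver ρ B T (dpInit ρ) := by
  have hn : 0 < P.n := by
    obtain ⟨v⟩ := hTree.connected.nonempty
    exact v.pos
  have huniv : (dpInit ρ).1.toFinset = Finset.univ := by ext; simp [dpInit]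
  have hmem : ∀ {v c}, c ∈ (dpInit ρ).2 v ↔
      ∃ a, (⟨a, 0, [(v, a)], ((ρ v a).num, (ρ v a).den)⟩ : Cand P) = c := by
    intro v c
    simp only [dpInit, List.mem_map, List.mem_ofFn']
    constructor
    · rintro ⟨a, _, rfl⟩; exact ⟨a, rfl⟩
    · rintro ⟨a, rfl⟩; exact ⟨a, ⟨(P.rank v).symm a, by simp⟩, rfl⟩
  have hval : ∀ q : ℚ≥0, fracVal (q.num, q.den) = q := fun q => NNRat.num_div_den q
  refine ⟨List.nodup_finRange _, ?_, ?_, ?_, ?_, ?_, ?_⟩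
  · exact List.ne_nil_of_mem (List.mem_finRange ⟨0, hn⟩)
  · rw [huniv]; exact Profile.treeClosed_univ T
  · refine ⟨fun v => {v}, fun v _ c hc => ?_, ?_⟩
    · obtain ⟨a, rfl⟩ := hmem.1 hc
      rfl
    · rw [huniv, Finset.sum_multiset_singleton]
  · intro v _ c hc
    obtain ⟨a, rfl⟩ := hmem.1 hc
    refine ⟨(ρ v a).den_pos, ?_, by simp, hn, by simpa using (hB v a).1, by simpa using (hB v a).2⟩
    simp only [hval, listCost, List.foldr_cons, List.foldr_nil]
    cases ver
    · exact (add_zero _).symm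
    · exact (max_eq_left zero_le).symm
  · intro v _
    simpa [dpInit] using Nat.le_mul_of_pos_right P.m hn
  · intro w _
    refine ⟨fun v => ⟨w v, 0, [(v, w v)], ((ρ v (w v)).num, (ρ v (w v)).den)⟩,
      fun v _ => ⟨hmem.2 ⟨w v, rfl⟩, rfl⟩, ?_, ?_⟩
    · rw [huniv, total_eq_agg]
      exact agg_mono ver fun v _ => (hval _).le
    · rw [huniv]; simp

theorem dpInv_foldl (hTree : T.IsTree) (hT : P.IntermediateOn T)
    (hB : ∀ v a, 2 * (ρ v a).num ≤ 2 ^ B ∧ 2 * (ρ v a).den ≤ 2 ^ B) (l : List (Fin P.n)) :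
    DPInv ver ρ B T (l.foldl (fun s _ => dpStep ver s) (dpInit ρ)) ∧
      (l.foldl (fun s _ => dpStep ver s) (dpInit ρ)).1.length ≤ max 1 (P.n - l.length) := by
  induction l using List.reverseRecOn with
  | nil => exact ⟨dpInv_init hTree hB, by simp [dpInit]⟩
  | append_singleton l v ih =>
    rw [List.foldl_append]
    refine ⟨ih.1.step hT, (ih.1.length_step hTree hT).trans ?_⟩
    have := ih.2
    simp only [List.length_append, List.length_singleton]
    omega

/-- Replacing all representatives by the favourite ones among them makes the sets of voters with a
common representative convex. -/
theorem exists_convexAssignment (hρ : P.IsMisrepresentation ρ) (ver : Version)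
    (w' : Fin P.n → Fin P.m) : ∃ w, ConvexAssignment w ∧ total ver ρ w ≤ total ver ρ w' ∧
      (Finset.univ.image w).card ≤ (Finset.univ.image w').card := by
  have hex : ∀ v, ∃ a ∈ Finset.univ.image w', ∀ b ∈ Finset.univ.image w', P.pos v a ≤ P.pos v b :=
    fun v => Finset.exists_min_image _ (P.pos v) ⟨w' v, by simp⟩
  choose w hw hmin using hex
  have hlt : ∀ v, ∀ b ∈ Finset.univ.image w', b ≠ w v → P.Prefers v (w v) b := fun v b hb hne =>
    lt_of_le_of_ne (hmin v b hb) fun h => hne ((P.rank v).symm.injective h).symm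
  refine ⟨w, fun u p v hb huv => ?_, ?_, ?_⟩
  -- Both `u` and `v` prefer their common favourite `w u` to `w p`; hence so does `p`, whose
  -- favourite is `w p`.
  · by_contra hne
    have h1 := hlt u (w p) (hw p) hne
    have h2 := hlt v (w p) (hw p) (by rwa [← huv])
    rw [← huv] at h2
    exact absurd (hb _ _ h1 h2) (hlt p (w u) (hw u) (Ne.symm hne)).asymm
  · rw [total_eq_agg, total_eq_agg]
    refine agg_mono ver fun v _ => ?_
    by_cases h : w' v = w v
    · rw [h]
    · exact hρ v _ _ (hlt v (w' v) (by simp) h)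
  · exact Finset.card_le_card fun a ha => by
      obtain ⟨v, _, rfl⟩ := Finset.mem_image.1 ha
      exact hw v

/-- With one voter left, its cluster consists of all voters, so its candidates are full assignments,
and `complete` gives at least one as cheap as any `k`-assignment and with fewer than `k` cuts. The
last clause is phrased in the way in which the program later reads off the representatives. -/
theorem dpResult_spec (hTree : T.IsTree) (hT : P.IntermediateOn T)
    (hB : ∀ v a, 2 * (ρ v a).num ≤ 2 ^ B ∧ 2 * (ρ v a).den ≤ 2 ^ B)
    (hρ : P.IsMisrepresentation ρ) (hm : 0 < P.m) {k : ℕ} (hk : 0 < k) :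
    ∃ c, dpResult ver ρ k = [c] ∧ ∃ w, IsOptimal ver ρ k w ∧
      ∀ v, ∃ l, (c.wit.filter fun x => decide (x.1 = v)) = (v, w v) :: l := by
  obtain ⟨h, hlen⟩ := dpInv_foldl (ver := ver) hTree hT hB (List.finRange P.n)
  rw [← dpRun, List.length_finRange, Nat.sub_self, max_eq_left zero_le_one] at hlen
  rw [← dpRun] at h
  unfold dpResult
  rcases hS : dpRun ver ρ with ⟨S, F⟩
  rw [hS] at h hlen
  obtain ⟨v, rfl⟩ : ∃ v, S = [v] :=
    List.length_eq_one_iff.1 (le_antisymm hlen (List.length_pos_iff.2 h.ne_nil))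
  simp only [List.flatMap_cons, List.flatMap_nil, List.append_nil]
  obtain ⟨C, hC, hsum⟩ := h.cluster
  have hfin : [v].toFinset = {v} := rfl
  simp only [hfin, Finset.sum_singleton] at hsum
  have hcomp : ∀ w', IsKAssignment k w' →
      ∃ c ∈ (F v).filter fun c => decide (c.cuts < k), fracVal c.cost ≤ total ver ρ w' := by
    intro w' hk'
    obtain ⟨w, hw, hle, hcard⟩ := exists_convexAssignment hρ ver w'
    obtain ⟨σ, hσ, hcost, hcuts⟩ := h.complete w hw
    simp only [hfin, agg_singleton, Finset.sum_singleton, Finset.image_singleton,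
      Finset.card_singleton] at hcost hcuts
    have : (Finset.univ.image w').card ≤ k := hk'
    exact ⟨σ v, by simp [(hσ v (by simp)).1]; omega, hcost.trans hle⟩
  have hpos : ∀ c ∈ (F v).filter fun c => decide (c.cuts < k), 0 < c.cost.2 := fun c hc =>
    (h.sound v (by simp) c (List.mem_of_mem_filter hc)).pos
  have hone := length_best_le ((F v).filter fun c => decide (c.cuts < k))
  rcases hbest : best ((F v).filter fun c => decide (c.cuts < k)) with _ | ⟨c, l⟩
  -- Some candidate survives, because a constant assignment is a `k`-assignment for `k ≥ 1`.
  · obtain ⟨c, hc, _⟩ := hcomp (fun _ => ⟨0, hm⟩)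
      ((Finset.card_le_one.2 (by simp +contextual)).trans hk)
    obtain ⟨d, hd, _⟩ := exists_best hpos hc
    rw [hbest] at hd
    simp at hd
  obtain rfl : l = [] := by
    rw [hbest] at hone
    exact List.length_eq_zero_iff.1 (by simpa using hone)
  have hmem : c ∈ (F v).filter fun c => decide (c.cuts < k) := mem_of_mem_best (by simp [hbest])
  have hcF := List.mem_of_mem_filter hmem
  have hsound := h.sound v (by simp) c hcF
  -- Every voter occurs exactly once in the witness, so it is the graph of a function.
  have hvoters : (c.wit.map Prod.fst : Multiset (Fin P.n)) = Finset.univ.val :=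
    (hC v (by simp) c hcF).trans hsum
  have hnodup : (c.wit.map Prod.fst).Nodup := by
    rw [← Multiset.coe_nodup, hvoters]; exact Finset.univ.nodup
  have huniv : (c.wit.map Prod.fst).toFinset = Finset.univ := by
    ext u
    simp only [List.mem_toFinset, Finset.mem_univ, iff_true]
    rw [← Multiset.mem_coe, hvoters]
    exact Finset.mem_univ u
  have hget : ∀ u, ∃ a l, (c.wit.filter fun x => decide (x.1 = u)) = (u, a) :: l := by
    intro u
    have hu : u ∈ (c.wit.map Prod.fst).toFinset := huniv ▸ Finset.mem_univ u
    rw [List.mem_toFinset, List.mem_map] at hu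
    obtain ⟨x, hx, rfl⟩ := hu
    rcases hf : c.wit.filter fun y => decide (y.1 = x.1) with _ | ⟨y, l⟩
    · have : x ∈ c.wit.filter fun y => decide (y.1 = x.1) := by simp [hx]
      rw [hf] at this
      simp at this
    · have : y ∈ c.wit.filter fun y => decide (y.1 = x.1) := by simp [hf]
      have := (List.mem_filter.1 this).2
      rw [decide_eq_true_eq] at this
      exact ⟨y.2, l, hf.trans (by rw [← this])⟩
  choose w hw using hget
  have hwmem : ∀ u, (u, w u) ∈ c.wit := fun u => by
    obtain ⟨l, hl⟩ := hw u
    exact List.mem_of_mem_filter (hl ▸ List.mem_cons_self)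
  have hwit : ∀ x ∈ c.wit, x.2 = w x.1 := fun x hx => by
    have := List.inj_on_of_nodup_map hnodup hx (hwmem x.1) rfl
    exact congrArg Prod.snd this
  have htotal : total ver ρ w = fracVal c.cost := by
    rw [hsound.val, listCost_eq_agg ver ρ w hwit hnodup, huniv, total_eq_agg]
  refine ⟨c, rfl, w, ⟨?_, fun w' hw' => ?_⟩, hw⟩
  · have h1 : Finset.univ.image w ⊆ insert c.lab (c.wit.map Prod.snd).toFinset := by
      intro a ha
      obtain ⟨u, _, rfl⟩ := Finset.mem_image.1 ha
      simp only [Finset.mem_insert, List.mem_toFinset, List.mem_map]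
      exact Or.inr ⟨_, hwmem u, rfl⟩
    have h2 := (List.mem_filter.1 hmem).2
    rw [decide_eq_true_eq] at h2
    exact (Finset.card_le_card h1).trans (hsound.card.trans h2)
  · obtain ⟨d, hd, hdle⟩ := hcomp w' hw'
    obtain ⟨e, he, hele⟩ := exists_best hpos hd
    rw [hbest, List.mem_singleton] at he
    subst he
    exact htotal.trans_le (hele.trans hdle)

end

/-! ## Encodings -/

section

variable {P : Profile}

/-- The ranking of a voter. -/
def rankData (v : Fin P.n) : Data :=
  .ofList ((List.ofFn (P.rank v)).map fun a => .ofNat a.val)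

/-- The number of a voter together with the ranking. -/
def voterData (v : Fin P.n) : Data := .cons (.ofNat v.val) (rankData v)

def fracData (x : ℕ × ℕ) : Data := .cons (.ofNat x.1) (.ofNat x.2)

def witData (l : List (Fin P.n × Fin P.m)) : Data :=
  .ofList (l.map fun x => .cons (.ofNat x.1.val) (.ofNat x.2.val))

def candData (c : Cand P) : Data :=
  .cons (.ofNat c.lab.val) (.cons (.ofNat c.cuts) (.cons (witData c.wit) (fracData c.cost)))

def tableData (l : List (Cand P)) : Data := .ofList (l.map candData)

def nodeData (F : Fin P.n → List (Cand P)) (v : Fin P.n) : Data :=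
  .cons (voterData v) (tableData (F v))

/-- Only the voters still present are stored, each with its ranking, so that betweenness can be
tested without lookups; values of the table function elsewhere do not matter. -/
def stateData (s : DPState P) : Data := .ofList (s.1.map (nodeData s.2))

theorem encode_eq (P : Profile) :
    P.encode = .ofList ((List.finRange P.n).map fun v => rankData v) := by
  rw [Profile.encode, List.ofFn_eq_map]
  congr 2
  funext v
  rw [rankData, List.map_ofFn]
  rfl

end

/-! ## The dynamic program runs in polynomial time -/

namespace PolyTime

open Data (ofList ofNat ofBool)

variable {ι : Type} {E : ι → Data} {P : ι → Profile}

/-- Recompute a value in an extended environment. -/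
theorem lift {β : ι → Type} {F : ι → Data} {G : (Σ i, β i) → Data} (h : PolyTime E F) :
    PolyTime (fun x : Σ i, β i => .cons (E x.1) (G x)) fun x => F x.1 :=
  (id _).fst.comp (h.reindex Sigma.fst)

theorem fin_eq {n : ι → ℕ} {a b : ∀ i, Fin (n i)} (ha : PolyTime E fun i => ofNat (a i).val)
    (hb : PolyTime E fun i => ofNat (b i).val) : PolyTime E fun i => ofBool (decide (a i = b i)) :=
  (nat_eq ha hb).congr fun i => by simp only [Fin.ext_iff]

/-- Positions are not computed: the ranking is filtered for the two alternatives, and the first hit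
is the preferred one. -/
theorem pos_le {u : ∀ i, Fin (P i).n} {a b : ∀ i, Fin (P i).m}
    (hu : PolyTime E fun i => rankData (u i)) (ha : PolyTime E fun i => ofNat (a i).val)
    (hb : PolyTime E fun i => ofNat (b i).val) :
    PolyTime E fun i => ofBool (decide ((P i).pos (u i) (a i) ≤ (P i).pos (u i) (b i))) := by
  have h1 := filter (L := fun i => List.ofFn ((P i).rank (u i)))
    (p := fun i c => decide (c = a i) || decide (c = b i)) hu
    ((fin_eq (id _).snd ha.lift).or (fin_eq (id _).snd hb.lift))
  have key : ∀ i, (ofList (((List.ofFn ((P i).rank (u i))).filter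
      fun c => decide (c = a i) || decide (c = b i)).map fun c => ofNat c.val)).fst =
      ofNat (if (P i).pos (u i) (a i) ≤ (P i).pos (u i) (b i) then a i else b i).val := by
    intro i
    have hd : (List.ofFn ((P i).rank (u i))).find? (fun c => decide (c = a i) || decide (c = b i)) =
        some (if (P i).pos (u i) (a i) ≤ (P i).pos (u i) (b i) then a i else b i) := by
      rw [List.find?_eq_some_iff_getElem]
      refine ⟨by split_ifs <;> simp, ?_⟩
      split_ifs with h
      · refine ⟨(P i).pos (u i) (a i), by simp, by simp [Profile.pos], fun j hj => ?_⟩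
        have hjm : j < (P i).m := hj.trans (Fin.is_lt _)
        simp only [List.getElem_ofFn, Bool.not_eq_true', Bool.or_eq_false_iff,
          decide_eq_false_iff_not, ← Equiv.eq_symm_apply]
        change ¬ _ = (P i).pos (u i) (a i) ∧ ¬ _ = (P i).pos (u i) (b i)
        simp only [Fin.ext_iff, Fin.le_def] at h ⊢
        omega
      · refine ⟨(P i).pos (u i) (b i), by simp, by simp [Profile.pos], fun j hj => ?_⟩
        have hjm : j < (P i).m := hj.trans (Fin.is_lt _)
        simp only [List.getElem_ofFn, Bool.not_eq_true', Bool.or_eq_false_iff,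
          decide_eq_false_iff_not, ← Equiv.eq_symm_apply]
        change ¬ _ = (P i).pos (u i) (a i) ∧ ¬ _ = (P i).pos (u i) (b i)
        simp only [Fin.ext_iff, Fin.le_def] at h ⊢
        omega
    rw [← List.head?_filter] at hd
    rcases hf : (List.ofFn ((P i).rank (u i))).filter
      (fun c => decide (c = a i) || decide (c = b i)) with _ | ⟨c, l⟩
    · rw [hf] at hd; simp at hd
    · rw [hf] at hd
      simp only [List.head?_cons, Option.some.injEq] at hd
      rw [← hd]
      rfl
  refine (fin_eq (h1.data_fst.congr key) ha).congr fun i => ?_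
  congr 1
  rw [decide_eq_decide]
  split_ifs with h
  · simp [h]
  · simp only [h, iff_false]
    intro h'
    exact h (by rw [h'])

/-- The test ranges over all pairs from the ranking of `u` and uses `≤` in place of strict
preference; this is equivalent because distinct alternatives have distinct positions and equal ones
satisfy the test trivially. -/
theorem between {u p v : ∀ i, Fin (P i).n} (hu : PolyTime E fun i => rankData (u i))
    (hp : PolyTime E fun i => rankData (p i)) (hv : PolyTime E fun i => rankData (v i)) :
    PolyTime E fun i => ofBool (decide ((P i).Between (u i) (p i) (v i))) := by
  let A : ι → Type := fun i => {a // a ∈ List.ofFn ((P i).rank (u i))}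
  let A' : (Σ i, A i) → Type := fun x => {b // b ∈ List.ofFn ((P x.1).rank (u x.1))}
  have ha : PolyTime
      (fun x : Σ x : Σ i, A i, A' x => .cons (.cons (E x.1.1) (ofNat x.1.2.1.val)) (ofNat x.2.1.val))
      fun x => ofNat x.1.2.1.val := (id _).fst.snd
  have hb : PolyTime
      (fun x : Σ x : Σ i, A i, A' x => .cons (.cons (E x.1.1) (ofNat x.1.2.1.val)) (ofNat x.2.1.val))
      fun x => ofNat x.2.1.val := (id _).snd
  have le : ∀ w : ∀ i, Fin (P i).n, PolyTime E (fun i => rankData (w i)) → PolyTime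
      (fun x : Σ x : Σ i, A i, A' x => .cons (.cons (E x.1.1) (ofNat x.1.2.1.val)) (ofNat x.2.1.val))
      fun x => ofBool (decide ((P x.1.1).pos (w x.1.1) x.1.2.1 ≤ (P x.1.1).pos (w x.1.1) x.2.1)) :=
    fun w hw => by
      have h1 := hw.lift (β := A) (G := fun x => ofNat x.2.1.val)
      have h2 := h1.lift (β := A') (G := fun x => ofNat x.2.1.val)
      have h3 := pos_le (P := fun x : Σ x : Σ i, A i, A' x => P x.1.1) (u := fun x => w x.1.1)
        (a := fun x => x.1.2.1) (b := fun x => x.2.1) h2 ha hb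
      exact h3
  have h1 := hu.lift (β := A) (G := fun x => ofNat x.2.1.val)
  have h2 := ((le u hu).and (le v hv)).not.or (le p hp)
  have inner := all (ι := Σ i, A i) (E := fun x => .cons (E x.1) (ofNat x.2.1.val))
    (eβ := fun x (b : Fin (P x.1).m) => ofNat b.val)
    (L := fun x => List.ofFn ((P x.1).rank (u x.1)))
    (p := fun x b => !(decide ((P x.1).pos (u x.1) x.2.1 ≤ (P x.1).pos (u x.1) b) &&
        decide ((P x.1).pos (v x.1) x.2.1 ≤ (P x.1).pos (v x.1) b)) ||
      decide ((P x.1).pos (p x.1) x.2.1 ≤ (P x.1).pos (p x.1) b)) h1 h2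
  refine (all (eβ := fun i (b : Fin (P i).m) => ofNat b.val) (L := fun i => List.ofFn ((P i).rank (u i)))
    (p := fun i a => (List.ofFn ((P i).rank (u i))).all fun b =>
      !(decide ((P i).pos (u i) a ≤ (P i).pos (u i) b) &&
        decide ((P i).pos (v i) a ≤ (P i).pos (v i) b)) ||
      decide ((P i).pos (p i) a ≤ (P i).pos (p i) b)) hu inner).congr fun i => ?_
  congr 1
  have mem : ∀ a, a ∈ List.ofFn ((P i).rank (u i)) := fun a =>
    (List.mem_ofFn' _ _).2 ⟨((P i).rank (u i)).symm a, by simp⟩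
  have inj : ∀ w a b, (P i).pos w a = (P i).pos w b → a = b :=
    fun w a b h => ((P i).rank w).symm.injective h
  rw [Bool.eq_iff_iff, decide_eq_true_eq]
  simp only [List.all_eq_true, mem, forall_true_left, Bool.or_eq_true, Bool.not_eq_true',
    Bool.and_eq_false_iff, decide_eq_false_iff_not, decide_eq_true_eq]
  constructor
  · intro h a b h1 h2
    rcases h a b with (h' | h') | h'
    · exact absurd h1.le h'
    · exact absurd h2.le h'
    · exact lt_of_le_of_ne h' fun h => h1.ne (inj _ _ _ h)
  · intro h a b
    by_cases hab : a = b
    · subst hab; simp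
    · by_contra! hc
      obtain ⟨⟨h1, h2⟩, h3⟩ := hc
      exact h3.not_gt (h a b (lt_of_le_of_ne h1 fun h => hab (inj _ _ _ h))
        (lt_of_le_of_ne h2 fun h => hab (inj _ _ _ h)))

theorem fracLt {x y : ι → ℕ × ℕ} (hx : PolyTime E fun i => fracData (x i))
    (hy : PolyTime E fun i => fracData (y i)) :
    PolyTime E fun i => ofBool (decide (FracLt (x i) (y i))) :=
  nat_lt (hx.fst.nat_mul hy.snd) (hy.fst.nat_mul hx.snd)

theorem fracOp (ver : Version) {x y : ι → ℕ × ℕ} (hx : PolyTime E fun i => fracData (x i))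
    (hy : PolyTime E fun i => fracData (y i)) :
    PolyTime E fun i => fracData (fracOp ver (x i) (y i)) := by
  cases ver with
  | utilitarian =>
    exact ((hx.fst.nat_mul hy.snd).nat_add (hy.fst.nat_mul hx.snd)).pair (hx.snd.nat_mul hy.snd)
  | egalitarian =>
    exact (ite (fracLt hx hy) hy hx).congr fun i => (apply_ite fracData _ _ _).symm

/-- The accumulator is always a sublist of the input, which bounds its size. -/
theorem best {l : ∀ i, List (Cand (P i))} (hl : PolyTime E fun i => tableData (l i)) :
    PolyTime E fun i => tableData (best (l i)) := by
  refine foldl (β := fun i => Cand (P i)) (σ := fun i => List (Cand (P i)))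
    (eβ := fun _ => candData) (eσ := fun _ => tableData) (L := l) (s₀ := fun _ => [])
    (step := fun _ acc c => if acc.all fun d => decide (FracLt c.cost d.cost) then [c] else acc)
    (inv := fun i (acc : List (Cand (P i))) => acc.Sublist (l i)) hl (nil E) (fun i => List.nil_sublist _) ?_ ?_ ?_
  · intro i acc c hc hacc
    split_ifs
    · exact List.singleton_sublist.2 hc
    · exact hacc
  · exact (hl.size.reindex Sigma.fst).mono_left fun x =>
      Data.size_ofList_mono (x.2.2.map candData)
  · have hid := id (fun x : Σ i, ({acc : List (Cand (P i)) // acc.Sublist (l i)} × {c // c ∈ l i}) =>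
      Data.cons (E x.1) (.cons (tableData x.2.1.1) (candData x.2.2.1)))
    refine (ite (p := fun x : Σ i, ({acc : List (Cand (P i)) // acc.Sublist (l i)} × {c // c ∈ l i}) =>
      (x.2.1.1.all fun d => decide (FracLt x.2.2.1.cost d.cost)) = true)
      ((all (L := fun x : Σ i, ({acc : List (Cand (P i)) // acc.Sublist (l i)} × {c // c ∈ l i}) => x.2.1.1)
        hid.snd.fst (fracLt hid.snd.snd.snd.snd.snd.lift (id _).snd.snd.snd.snd)).congr
          fun x => by rw [Bool.decide_eq_true])
      (hid.snd.snd.pair (nil _)) hid.snd.fst).congr fun x => ?_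
    split_ifs <;> rfl

/-- The list of numbered voters doubles as the range of the possible numbers of cuts. -/
theorem prune {l : ∀ i, List (Cand (P i))} {p : ∀ i, Fin (P i).n}
    (hV : PolyTime E fun i => ofList ((List.finRange (P i).n).map voterData))
    (hl : PolyTime E fun i => tableData (l i)) (hp : PolyTime E fun i => rankData (p i)) :
    PolyTime E fun i => tableData (prune (p i) (l i)) := by
  let A : ι → Type := fun i => {a // a ∈ List.ofFn ((P i).rank (p i))}
  let J : (Σ i, A i) → Type := fun x => {j // j ∈ List.finRange (P x.1).n}
  have ha : PolyTime
      (fun x : Σ x : Σ i, A i, J x => .cons (.cons (E x.1.1) (ofNat x.1.2.1.val)) (voterData x.2.1))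
      fun x => ofNat x.1.2.1.val := (id _).fst.snd
  have hj : PolyTime
      (fun x : Σ x : Σ i, A i, J x => .cons (.cons (E x.1.1) (ofNat x.1.2.1.val)) (voterData x.2.1))
      fun x => ofNat x.2.1.val := (id _).snd.fst
  have h1 := hl.lift (β := A) (G := fun x => ofNat x.2.1.val)
  have h2 := h1.lift (β := J) (G := fun x => voterData x.2.1)
  have hf := filter (ι := Σ x : Σ i, A i, J x)
    (E := fun x => .cons (.cons (E x.1.1) (ofNat x.1.2.1.val)) (voterData x.2.1))
    (eβ := fun _ => candData) (L := fun x => l x.1.1)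
    (p := fun x c => decide (c.lab = x.1.2.1) && decide (c.cuts = x.2.1.val)) h2
    ((fin_eq (id _).snd.fst ha.lift).and (nat_eq (id _).snd.snd.fst hj.lift))
  have h3 := hV.lift (β := A) (G := fun x => ofNat x.2.1.val)
  have h4 := best (P := fun x : Σ x : Σ i, A i, J x => P x.1.1) hf
  have inner := flatMap (ι := Σ i, A i) (E := fun x => .cons (E x.1) (ofNat x.2.1.val))
    (eβ := fun _ => voterData) (L := fun x => List.finRange (P x.1).n)
    (F := fun x j => (CC.best ((l x.1).filter fun c =>
      decide (c.lab = x.2.1) && decide (c.cuts = j.val))).map candData) h3 h4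
  have := flatMap (eβ := fun i (a : Fin (P i).m) => ofNat a.val) (L := fun i => List.ofFn ((P i).rank (p i)))
    (F := fun i a => (List.finRange (P i).n).flatMap fun j =>
      (CC.best ((l i).filter fun c => decide (c.lab = a) && decide (c.cuts = j.val))).map candData)
    hp inner
  refine this.congr fun i => ?_
  rw [tableData, CC.prune, List.map_flatMap]
  simp only [List.map_flatMap]

theorem join (ver : Version) {c d : ∀ i, Cand (P i)} (hc : PolyTime E fun i => candData (c i))
    (hd : PolyTime E fun i => candData (d i)) :
    PolyTime E fun i => candData ((c i).join ver (d i)) := by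
  refine hc.fst.pair (PolyTime.pair ?_ (PolyTime.pair ?_ (fracOp ver hc.snd.snd.snd hd.snd.snd.snd)))
  · refine hc.snd.fst.nat_add (hd.snd.fst.nat_add ?_)
    exact (ite (fin_eq hc.fst hd.fst) (const E (ofNat 0)) (const E (ofNat 1))).congr
      fun i => (apply_ite ofNat _ _ _).symm
  · exact (append hc.snd.snd.fst hd.snd.snd.fst).congr fun i => by
      rw [← List.map_append]; rfl

theorem mergeTable (ver : Version) {F : ∀ i, Fin (P i).n → List (Cand (P i))}
    {v p : ∀ i, Fin (P i).n}
    (hV : PolyTime E fun i => ofList ((List.finRange (P i).n).map voterData))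
    (hv : PolyTime E fun i => nodeData (F i) (v i))
    (hp : PolyTime E fun i => nodeData (F i) (p i)) :
    PolyTime E fun i => tableData (mergeTable ver (F i) (v i) (p i)) := by
  refine prune hV ?_ hp.fst.snd
  have h1 := id fun x : Σ i, {c // c ∈ F i (p i)} => Data.cons (E x.1) (candData x.2.1)
  refine (flatMap (F := fun i c => (F i (v i)).map fun d => candData (c.join ver d)) hp.snd
    (map hv.snd.lift (join ver h1.snd.lift (id _).snd))).congr fun i => ?_
  rw [tableData, List.map_flatMap]
  simp only [List.map_map]
  rfl

theorem gatePairs {s : ∀ i, DPState (P i)} (hs : PolyTime E fun i => stateData (s i)) :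
    PolyTime E fun i => ofList ((gatePairs (s i).1).map fun x =>
      .cons (nodeData (s i).2 x.1) (nodeData (s i).2 x.2)) := by
  refine filter (L := fun i => (s i).1.flatMap fun v => (s i).1.map fun p => (v, p))
    (eβ := fun i x => .cons (nodeData (s i).2 x.1) (nodeData (s i).2 x.2))
    (p := fun i x => !decide (x.1 = x.2) && (s i).1.all fun u =>
      decide (u = x.1) || decide ((P i).Between u x.2 x.1)) ?_ ?_
  · have h1 := id fun x : Σ i, {v // v ∈ (s i).1} =>
      Data.cons (E x.1) (nodeData (s x.1).2 x.2.1)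
    refine (flatMap (F := fun i v => (s i).1.map fun p =>
      .cons (nodeData (s i).2 v) (nodeData (s i).2 p)) hs
      (map hs.lift (h1.snd.lift.pair (id _).snd))).congr fun i => ?_
    rw [List.map_flatMap]
    simp only [List.map_map]
    rfl
  · have h1 := id fun x : Σ i, {y // y ∈ (s i).1.flatMap fun v => (s i).1.map fun p => (v, p)} =>
      Data.cons (E x.1) (.cons (nodeData (s x.1).2 x.2.1.1) (nodeData (s x.1).2 x.2.1.2))
    exact (fin_eq h1.snd.fst.fst.fst h1.snd.snd.fst.fst).not.and
      (all hs.lift ((fin_eq (id _).snd.fst.fst h1.snd.fst.fst.fst.lift).or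
        (between (id _).snd.fst.snd h1.snd.snd.fst.snd.lift h1.snd.fst.fst.snd.lift)))

theorem dpStep (ver : Version) {s : ∀ i, DPState (P i)}
    (hV : PolyTime E fun i => ofList ((List.finRange (P i).n).map voterData))
    (hs : PolyTime E fun i => stateData (s i)) :
    PolyTime E fun i => stateData (dpStep ver (s i)) := by
  have hg := gatePairs hs
  -- The elimination branch is analysed only on the indices that reach it, where the first pair
  -- exists.
  let κ := {i // CC.gatePairs (s i).1 ≠ []}
  let v : ∀ k : κ, Fin (P k.1).n := fun k => ((CC.gatePairs (s k.1).1).head k.2).1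
  let p : ∀ k : κ, Fin (P k.1).n := fun k => ((CC.gatePairs (s k.1).1).head k.2).2
  have hhead : PolyTime (fun k : κ => E k.1) fun k =>
      .cons (nodeData (s k.1).2 (v k)) (nodeData (s k.1).2 (p k)) := by
    refine (hg.data_fst.reindex (Subtype.val : κ → ι)).congr fun k => ?_
    obtain ⟨x, l, hl⟩ := List.exists_cons_of_ne_nil k.2
    have : (CC.gatePairs (s k.1).1).head k.2 = x := by simp [hl]
    simp only [v, p, this]
    rw [hl]
    rfl
  have hVk := hV.reindex (Subtype.val : κ → ι)
  have hnew : PolyTime (fun k : κ => E k.1) fun k => stateData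
      ((s k.1).1.filter fun u => !decide (u = v k),
        fun u => if u = p k then CC.mergeTable ver (s k.1).2 (v k) (p k) else (s k.1).2 u) := by
    refine map (L := fun k : κ => (s k.1).1.filter fun u => !decide (u = v k))
      (eβ := fun k => nodeData (s k.1).2) ?_ ?_
    · exact filter (hs.reindex (Subtype.val : κ → ι))
        (fin_eq (id _).snd.fst.fst hhead.fst.fst.fst.lift).not
    · refine (id _).snd.fst.pair ?_
      exact (ite (fin_eq (id _).snd.fst.fst hhead.snd.fst.fst.lift)
        (mergeTable ver hVk hhead.fst hhead.snd).lift (id _).snd.snd).congr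
          fun x => (apply_ite tableData _ _ _).symm
  refine (cond (p := fun i => CC.gatePairs (s i).1 ≠ [])
    (F := fun i => stateData (CC.dpStep ver (s i))) (G := fun i => stateData (s i)) hg
    (fun i => ?_) (hnew.congr fun k => ?_) (hs.reindex Subtype.val)).congr fun i => ?_
  · cases CC.gatePairs (s i).1 <;> simp [ofList]
  · obtain ⟨x, l, hl⟩ := List.exists_cons_of_ne_nil k.2
    have : (CC.gatePairs (s k.1).1).head k.2 = x := by simp [hl]
    simp only [v, p, this, CC.dpStep]
    rw [hl]
  · split_ifs with h
    · rfl
    · rw [not_not] at h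
      rw [CC.dpStep, h]

end PolyTime

/-! ### Numbering the voters and the initial tables -/

namespace PolyTime

open Data (ofList ofNat ofBool)

variable {ι : Type} {E : ι → Data} {P : ι → Profile}

/-- The encoding of a profile identifies voters only by their place in a list; a counter makes the
numbers explicit. The numbered list comes out reversed. -/
theorem foldl_number {β : Type} (l : List β) :
    l.foldl (fun (s : ℕ × List (ℕ × β)) b => (s.1 + 1, (s.1, b) :: s.2)) (0, []) =
      (l.length, (l.zipIdx.map Prod.swap).reverse) := by
  induction l using List.reverseRecOn with
  | nil => rfl
  | append_singleton l b ih => simp [List.foldl_append, ih, List.zipIdx_append]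

theorem nat_size_le_self (a : ℕ) : (ofNat a).size ≤ 4 * a + 1 := by
  have := Data.size_ofNat_le a
  have : a.size ≤ a := Nat.size_le.2 Nat.lt_two_pow_self
  omega

/-- The voters can be numbered. -/
theorem voters (hP : PolyTime E fun i => (P i).encode) :
    PolyTime E fun i => ofList ((List.finRange (P i).n).map voterData) := by
  have hL : PolyTime E fun i => ofList ((List.finRange (P i).n).map fun v => rankData v) :=
    hP.congr fun i => encode_eq (P i)
  let eσ : ∀ i, ℕ × List (ℕ × Fin (P i).n) → Data := fun i s =>
    .cons (ofNat s.1) (ofList (s.2.map fun x => .cons (ofNat x.1) (rankData x.2)))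
  have := foldl_of_prefix (β := fun i => Fin (P i).n) (σ := fun i => ℕ × List (ℕ × Fin (P i).n))
    (eβ := fun i v => rankData v) (eσ := eσ) (L := fun i => List.finRange (P i).n)
    (s₀ := fun _ => (0, [])) (step := fun _ s b => (s.1 + 1, (s.1, b) :: s.2)) hL
    ((const E (ofNat 0)).pair (nil E)) ?_ ?_
  · refine (reverse (L := fun i => ((List.finRange (P i).n).zipIdx.map Prod.swap).reverse.map
      fun x => .cons (ofNat x.1) (rankData x.2)) (this.snd.congr fun i => ?_)).congr fun i => ?_
    · rw [foldl_number]
    · rw [← List.map_reverse, List.reverse_reverse, List.map_map]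
      congr 1
      apply List.ext_getElem <;> simp [voterData]
  · have hlen := hL.length
    simp only [List.length_finRange] at hlen
    have hb := (((PolyBound.const 4 _).mul hlen).add (.const 3 _)).add
      (hlen.mul ((((PolyBound.const 4 _).mul hlen).add hL.size).add (.const 4 _)))
    refine (hb.reindex Sigma.fst).mono_left fun x => ?_
    have hx : x.2.1 ≤ (P x.1).n := by simpa using x.2.2
    rw [foldl_number]
    simp only [eσ, Data.size]
    have h1 := nat_size_le_self ((List.finRange (P x.1).n).take x.2.1).length
    have h2 : ((List.finRange (P x.1).n).take x.2.1).length ≤ (P x.1).n := by simp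
    have h3 := Data.size_ofList_le (n := (P x.1).n)
      (s := 4 * (P x.1).n + (ofList ((List.finRange (P x.1).n).map fun v => rankData v)).size + 2)
      (l := ((((List.finRange (P x.1).n).take x.2.1).zipIdx.map Prod.swap).reverse.map
        fun y => .cons (ofNat y.1) (rankData y.2))) (by simp) (by
          intro d hd
          simp only [List.mem_map, List.mem_reverse] at hd
          obtain ⟨_, ⟨⟨v, j⟩, hvj, rfl⟩, rfl⟩ := hd
          have h4 := nat_size_le_self j
          have h5 := (List.mem_zipIdx hvj).2.1
          have h6 := Data.size_le_size_ofList
            (List.mem_map_of_mem (f := fun v => rankData v) (List.mem_finRange v))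
          simp only [Prod.swap, Data.size]
          omega)
    have e : 4 * (P x.1).n + (ofList ((List.finRange (P x.1).n).map fun v => rankData v)).size + 2 + 1
      ≤ 4 * (P x.1).n + (ofList ((List.finRange (P x.1).n).map fun v => rankData v)).size + 4 := by
      omega
    have := Nat.mul_le_mul_left (P x.1).n e
    omega
  · have hid := id fun x : Σ i, {j // j < (List.finRange (P i).n).length} =>
      Data.cons (E x.1) (.cons (eσ x.1 (((List.finRange (P x.1).n).take x.2).foldl
        (fun s b => (s.1 + 1, (s.1, b) :: s.2)) (0, [])))
          (rankData ((List.finRange (P x.1).n)[x.2.1]'x.2.2)))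
    exact (hid.snd.fst.fst.nat_add (const _ (ofNat 1))).pair
      ((hid.snd.fst.fst.pair hid.snd.snd).pair hid.snd.fst.snd)

/-- The program for the misrepresentation function is run as a subroutine on every pair of a voter
and an alternative; `hρ` has those pairs in its index type. -/
theorem dpInit {X : ι → Data} {ρ : ∀ i, Fin (P i).n → Fin (P i).m → ℚ≥0}
    (hP : PolyTime E fun i => (P i).encode) (hX : PolyTime E X)
    (hρ : PolyTime (fun x : Σ i, Fin (P i).n × Fin (P i).m =>
      .cons (P x.1).encode (.cons (X x.1) (.cons (ofNat x.2.1) (ofNat x.2.2))))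
      fun x => .ofRat (ρ x.1 x.2.1 x.2.2)) :
    PolyTime E fun i => stateData (dpInit (ρ i)) := by
  let V : ι → Type := fun i => {v // v ∈ List.finRange (P i).n}
  let A : (Σ i, V i) → Type := fun x => {a // a ∈ List.ofFn ((P x.1).rank x.2.1)}
  have hid := id fun x : Σ x : Σ i, V i, A x =>
    Data.cons (.cons (E x.1.1) (voterData x.1.2.1)) (ofNat x.2.1.val)
  have hv := hid.fst.snd.fst
  have ha := hid.snd
  have h1 := hP.lift (β := V) (G := fun x => voterData x.2.1)
  have h2 := h1.lift (β := A) (G := fun x => ofNat x.2.1.val)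
  have h3 := hX.lift (β := V) (G := fun x => voterData x.2.1)
  have h4 := h3.lift (β := A) (G := fun x => ofNat x.2.1.val)
  have h5 := (h2.pair (h4.pair (hv.pair ha))).comp
    (hρ.reindex fun x : Σ x : Σ i, V i, A x => ⟨x.1.1, x.1.2.1, x.2.1⟩)
  have h6 := ha.pair ((const _ (ofNat 0)).pair (((hv.pair ha).pair (nil _)).pair h5))
  have h7 := id fun x : Σ i, V i => Data.cons (E x.1) (voterData x.2.1)
  have h8 := map (ι := Σ i, V i) (E := fun x => .cons (E x.1) (voterData x.2.1))
    (eβ := fun x (a : Fin (P x.1).m) => ofNat a.val) (L := fun x => List.ofFn ((P x.1).rank x.2.1))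
    (F := fun x a => candData (P := P x.1)
      ⟨a, 0, [(x.2.1, a)], ((ρ x.1 x.2.1 a).num, (ρ x.1 x.2.1 a).den)⟩) h7.snd.snd h6
  have h9 := map (eβ := fun i (v : Fin (P i).n) => voterData v)
    (L := fun i => List.finRange (P i).n)
    (F := fun i v => .cons (voterData v) (ofList ((List.ofFn ((P i).rank v)).map fun a =>
      candData (P := P i) ⟨a, 0, [(v, a)], ((ρ i v a).num, (ρ i v a).den)⟩))) (voters hP)
    (h7.snd.pair h8)
  refine h9.congr fun i => ?_
  rw [stateData, CC.dpInit]
  congr 1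
  refine List.map_congr_left fun v _ => ?_
  rw [nodeData, tableData, List.map_map]
  rfl

end PolyTime

/-- A bound for the sizes of the states of the dynamic program. -/
def stateBound (V n m B : ℕ) : ℕ :=
  n * (V + (m * n * (4 * m + 4 * n + n * (4 * m + 4 * n + 4) + 8 * (B * n) + 20) + 20) + 1) + 1

/-- A witness lists distinct voters, hence at most `n` entries, and so costs have at most `B * n`
bits; the remaining constants are generous. -/
theorem size_stateData_le {P : Profile} {ver : Version} {ρ : Fin P.n → Fin P.m → ℚ≥0} {B : ℕ}
    {T : SimpleGraph (Fin P.n)} {s : DPState P} (h : DPInv ver ρ B T s) {V : ℕ}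
    (hV : ∀ v : Fin P.n, (voterData v).size ≤ V) :
    (stateData s).size ≤ stateBound V P.n P.m B := by
  obtain ⟨C, hC, hsum⟩ := h.cluster
  have hcand : ∀ v ∈ s.1, ∀ c ∈ s.2 v, (candData c).size ≤
      4 * P.m + 4 * P.n + P.n * (4 * P.m + 4 * P.n + 4) + 8 * (B * P.n) + 10 := by
    intro v hv c hc
    have hs := h.sound v hv c hc
    have hwit : c.wit.length ≤ P.n := by
      have h1 : C v ≤ Finset.univ.val := hsum ▸
        Finset.single_le_sum (f := C) (fun _ _ => zero_le) (List.mem_toFinset.2 hv)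
      have h2 := Multiset.card_le_card h1
      rw [← hC v hv c hc] at h2
      simpa using h2
    have hcost : ∀ a, 2 * a ≤ 2 ^ (B * c.wit.length) → (Data.ofNat a).size ≤ 4 * (B * P.n) + 1 := by
      intro a ha
      have h1 := Data.size_ofNat_le a
      have h2 : a.size ≤ B * c.wit.length := by
        have : 0 < 2 ^ (B * c.wit.length) := by positivity
        exact Nat.size_le.2 (by omega)
      have h3 := Nat.mul_le_mul_left B hwit
      omega
    have h1 := hcost _ hs.num_le
    have h2 := hcost _ hs.den_le
    have h3 := PolyTime.nat_size_le_self c.lab.val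
    have h4 := c.lab.isLt
    have h5 := PolyTime.nat_size_le_self c.cuts
    have h6 := hs.cuts
    have h7 : (witData c.wit).size ≤ P.n * (4 * P.m + 4 * P.n + 4) + 1 := by
      refine Data.size_ofList_le (s := 4 * P.m + 4 * P.n + 3) (by simpa using hwit) fun d hd => ?_
      obtain ⟨x, _, rfl⟩ := List.mem_map.1 hd
      have h1 := PolyTime.nat_size_le_self x.1.val
      have h2 := PolyTime.nat_size_le_self x.2.val
      simp only [Data.size]
      omega
    simp only [candData, fracData, Data.size]
    omega
  refine Data.size_ofList_le ?_ fun d hd => ?_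
  · rw [List.length_map]
    simpa using h.nodup.length_le_card
  · obtain ⟨v, hv, rfl⟩ := List.mem_map.1 hd
    have h1 := Data.size_ofList_le (l := (s.2 v).map candData) (by simpa using h.length v hv)
      (fun d hd => by
        obtain ⟨c, hc, rfl⟩ := List.mem_map.1 hd
        exact hcand v hv c hc)
    have h2 := hV v
    have h3 : P.m * P.n * (4 * P.m + 4 * P.n + P.n * (4 * P.m + 4 * P.n + 4) + 8 * (B * P.n) + 10 + 1)
        ≤ P.m * P.n * (4 * P.m + 4 * P.n + P.n * (4 * P.m + 4 * P.n + 4) + 8 * (B * P.n) + 20) :=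
      Nat.mul_le_mul_left _ (by omega)
    simp only [nodeData, tableData, Data.size]
    omega

theorem PolyBound.stateBound {ι : Type} {g V n m B : ι → ℕ} (hV : PolyBound V g)
    (hn : PolyBound n g) (hm : PolyBound m g) (hB : PolyBound B g) :
    PolyBound (fun i => stateBound (V i) (n i) (m i) (B i)) g := by
  have c : ∀ c : ℕ, PolyBound (fun _ => c) g := fun c => .const c g
  exact (hn.mul ((hV.add (((hm.mul hn).mul ((((((c 4).mul hm).add ((c 4).mul hn)).add
    (hn.mul ((((c 4).mul hm).add ((c 4).mul hn)).add (c 4)))).add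
    ((c 8).mul (hB.mul hn))).add (c 20))).add (c 20))).add (c 1))).add (c 1)

/-! ### Running time of the whole dynamic program -/

namespace PolyTime

open Data (ofList ofNat ofBool)

variable {ι : Type} {E : ι → Data} {P : ι → Profile}

theorem size_num_voters (hP : PolyTime E fun i => (P i).encode) :
    PolyBound (fun i => (P i).n) fun i => (E i).size := by
  have := (voters hP).length
  simpa using this

/-- A voter is needed: without voters the encoding does not depend on the number of alternatives. -/
theorem size_num_alternatives (hP : PolyTime E fun i => (P i).encode) (hn : ∀ i, 0 < (P i).n) :
    PolyBound (fun i => (P i).m) fun i => (E i).size := by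
  refine (voters hP).size.mono_left fun i => ?_
  have h1 := Data.size_le_size_ofList
    (List.mem_map_of_mem (f := voterData) (List.mem_finRange (⟨0, hn i⟩ : Fin (P i).n)))
  have h2 := Data.length_le_size_ofList
    ((List.ofFn ((P i).rank ⟨0, hn i⟩)).map fun a => ofNat a.val)
  rw [List.length_map, List.length_ofFn] at h2
  rw [voterData, rankData, Data.size] at h1
  omega

/-- The trees `T i` occur only in the invariant that bounds the states; they are not part of the
input. -/
theorem dpRun (ver : Version) {X : ι → Data} {ρ : ∀ i, Fin (P i).n → Fin (P i).m → ℚ≥0}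
    {B : ι → ℕ} {T : ∀ i, SimpleGraph (Fin (P i).n)}
    (hP : PolyTime E fun i => (P i).encode) (hX : PolyTime E X)
    (hρ : PolyTime (fun x : Σ i, Fin (P i).n × Fin (P i).m =>
      .cons (P x.1).encode (.cons (X x.1) (.cons (ofNat x.2.1) (ofNat x.2.2))))
      fun x => .ofRat (ρ x.1 x.2.1 x.2.2))
    (hTree : ∀ i, (T i).IsTree) (hT : ∀ i, (P i).IntermediateOn (T i))
    (hB : ∀ i v a, 2 * (ρ i v a).num ≤ 2 ^ B i ∧ 2 * (ρ i v a).den ≤ 2 ^ B i)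
    (hBE : PolyBound B fun i => (E i).size) :
    PolyTime E fun i => stateData (dpRun ver (ρ i)) := by
  have hV := voters hP
  have hn : ∀ i, 0 < (P i).n := fun i => by
    obtain ⟨v⟩ := (hTree i).connected.nonempty
    exact v.pos
  refine foldl (β := fun i => Fin (P i).n) (σ := fun i => DPState (P i))
    (eβ := fun _ => voterData) (eσ := fun _ => stateData) (L := fun i => List.finRange (P i).n)
    (s₀ := fun i => CC.dpInit (ρ i)) (step := fun _ s _ => CC.dpStep ver s)
    (inv := fun i s => DPInv ver (ρ i) (B i) (T i) s) hV (dpInit hP hX hρ)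
    (fun i => dpInv_init (hTree i) (hB i)) (fun i s _ _ h => h.step (hT i)) ?_ ?_
  · refine ((hV.size.stateBound (size_num_voters hP) (size_num_alternatives hP hn) hBE).reindex
      Sigma.fst).mono_left fun x => size_stateData_le x.2.2 fun v => ?_
    exact Data.size_le_size_ofList (List.mem_map_of_mem (List.mem_finRange v))
  · let S : ι → Type := fun i =>
      {s // DPInv ver (ρ i) (B i) (T i) s} × {b // b ∈ List.finRange (P i).n}
    have h1 := hV.lift (β := S) (G := fun x => .cons (stateData x.2.1.1) (voterData x.2.2.1))
    have h2 := id fun x : Σ i, S i =>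
      Data.cons (E x.1) (.cons (stateData x.2.1.1) (voterData x.2.2.1))
    exact dpStep (P := fun x : Σ i, S i => P x.1) (s := fun x => x.2.1.1) ver h1 h2.snd.fst

theorem dpResult (ver : Version) {ρ : ∀ i, Fin (P i).n → Fin (P i).m → ℚ≥0} {k : ι → ℕ}
    (hrun : PolyTime E fun i => stateData (CC.dpRun ver (ρ i)))
    (hk : PolyTime E fun i => ofNat (k i)) :
    PolyTime E fun i => tableData (dpResult ver (ρ i) (k i)) := by
  refine best ?_
  have h1 : PolyTime E fun i =>
      tableData ((CC.dpRun ver (ρ i)).1.flatMap (CC.dpRun ver (ρ i)).2) := by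
    refine (flatMap (F := fun i v => ((CC.dpRun ver (ρ i)).2 v).map candData) hrun
      (id _).snd.snd).congr fun i => ?_
    rw [tableData, List.map_flatMap]
  have h2 := hk.lift
    (β := fun i => {c // c ∈ (CC.dpRun ver (ρ i)).1.flatMap (CC.dpRun ver (ρ i)).2})
    (G := fun x => candData x.2.1)
  exact filter h1 (nat_lt (id _).snd.snd.fst h2)

/-- Read off an assignment from a list of pairs. -/
theorem assignment {w : ∀ i, Fin (P i).n → Fin (P i).m}
    {l : ∀ i, List (Fin (P i).n × Fin (P i).m)}
    (hV : PolyTime E fun i => ofList ((List.finRange (P i).n).map voterData))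
    (hl : PolyTime E fun i => witData (l i))
    (hw : ∀ i v, ∃ t, ((l i).filter fun x => decide (x.1 = v)) = (v, w i v) :: t) :
    PolyTime E fun i => encodeAssignment (w i) := by
  let V : ι → Type := fun i => {v // v ∈ List.finRange (P i).n}
  have h1 := hl.lift (β := V) (G := fun x => voterData x.2.1)
  have h2 := id fun x : Σ i, V i => Data.cons (E x.1) (voterData x.2.1)
  have h3 := filter (ι := Σ i, V i) (L := fun x => l x.1)
    (p := fun x y => decide (y.1 = x.2.1)) h1 (fin_eq (id _).snd.fst h2.snd.fst.lift)
  have h4 : PolyTime (fun x : Σ i, V i => .cons (E x.1) (voterData x.2.1))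
      fun x => ofNat (w x.1 x.2.1).val := by
    refine h3.data_fst.data_snd.congr fun x => ?_
    obtain ⟨t, ht⟩ := hw x.1 x.2.1
    rw [ht]
    rfl
  refine (map (F := fun i v => ofNat (w i v).val) hV h4).congr fun i => ?_
  rw [encodeAssignment, List.ofFn_eq_map]

end PolyTime

/-! ### From programs to solvability, and the main theorem -/

theorem PolyTimeSolvable.polyTime {ι : Type} {input F : ι → Data}
    (h : PolyTimeSolvable input (fun _ => True) fun i y => y = F i) : PolyTime input F := by
  obtain ⟨p, q, h⟩ := h
  refine .of_exists p (B := fun i => q.eval (input i).size) ⟨q, fun _ => le_rfl⟩ fun i => ?_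
  obtain ⟨y, t, hr, ht, rfl⟩ := h i trivial
  exact ⟨t, ht, hr⟩

theorem PolyTime.solvable {ι : Type} {input : ι → Data} {Valid : ι → Prop}
    {IsAnswer : ι → Data → Prop} {F : {i // Valid i} → Data}
    (h : PolyTime (fun i : {i // Valid i} => input i) F) (hF : ∀ i, IsAnswer i.1 (F i)) :
    PolyTimeSolvable input Valid IsAnswer := by
  obtain ⟨p, t, ⟨q, hq⟩, hr⟩ := h
  exact ⟨p, q, fun i hi => ⟨_, _, hr ⟨i, hi⟩, hq ⟨i, hi⟩, hF ⟨i, hi⟩⟩⟩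

theorem two_mul_le_of_size {a B : ℕ} (h : (Data.ofNat a).size ≤ B) : 2 * a ≤ 2 ^ (B + 1) := by
  have h1 := Nat.lt_size_self a
  have h2 := Nat.pow_le_pow_right (n := 2) (by norm_num) ((Data.nat_size_le a).trans h)
  rw [pow_succ]
  omega

end CC

theorem mainTheorem6 (r : CC.MisrepresentationFunction) (hr : CC.PolyTimeComputable r)
    (ver : CC.Version) :
    CC.PolyTimeSolvable CC.Instance.encode
      (fun I => 0 < I.k ∧ 0 < I.P.m ∧ I.P.SingleCrossingOnTree ∧
        I.P.IsMisrepresentation (r I.P I.x))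
      (fun I y => ∃ w : Fin I.P.n → Fin I.P.m,
        CC.IsOptimal ver (r I.P I.x) I.k w ∧ y = CC.encodeAssignment w) := by
  open CC in
  let ι := {I : Instance // 0 < I.k ∧ 0 < I.P.m ∧ I.P.SingleCrossingOnTree ∧
    I.P.IsMisrepresentation (r I.P I.x)}
  have hid := PolyTime.id fun i : ι => i.1.encode
  have hP : PolyTime (fun i : ι => i.1.encode) fun i => i.1.P.encode := hid.fst
  have hX : PolyTime (fun i : ι => i.1.encode) fun i => i.1.x := hid.snd.fst
  have hk : PolyTime (fun i : ι => i.1.encode) fun i => .ofNat i.1.k := hid.snd.snd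
  choose T hTree hT using fun i : ι => i.2.2.2.1
  have hn : ∀ i : ι, 0 < i.1.P.n := fun i => by
    obtain ⟨v⟩ := (hTree i).connected.nonempty
    exact v.pos
  have hρ := hr.polyTime.reindex fun x : Σ i : ι, Fin i.1.P.n × Fin i.1.P.m =>
    ⟨x.1.1.P, x.1.1.x, x.2.1, x.2.2⟩
  obtain ⟨q, hq⟩ := hρ.size
  -- A bound for the size of every query about the instance: besides profile and datum it contains
  -- the numbers of a voter and an alternative, whose encodings have size at most `4 * n + 1` and `4
  -- * m + 1`.
  let S : ι → ℕ := fun i => i.1.encode.size + 4 * i.1.P.n + 4 * i.1.P.m + 5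
  have hS : PolyBound S fun i : ι => i.1.encode.size :=
    ((((PolyBound.refl _).add ((PolyBound.const 4 _).mul (PolyTime.size_num_voters hP))).add
      ((PolyBound.const 4 _).mul (PolyTime.size_num_alternatives hP hn))).add (.const 5 _))
  have hsize : ∀ (i : ι) v a, (Data.ofRat (r i.1.P i.1.x v a)).size ≤ q.eval (S i) := by
    intro i v a
    refine (hq ⟨i, v, a⟩).trans (polynomial_eval_mono q ?_)
    have h1 := PolyTime.nat_size_le_self v.val
    have h2 := PolyTime.nat_size_le_self a.val
    have h3 := v.isLt
    have h4 := a.isLt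
    have h5 := (Data.ofNat i.1.k).one_le_size
    simp only [S, Query.encode, Instance.encode, Data.size]
    omega
  -- A bound on the output of `r` bounds the bit lengths of its values; the additional 1 in the
  -- exponent absorbs the factor 2.
  have hB : ∀ (i : ι) v a, 2 * (r i.1.P i.1.x v a).num ≤ 2 ^ (q.eval (S i) + 1) ∧
      2 * (r i.1.P i.1.x v a).den ≤ 2 ^ (q.eval (S i) + 1) := by
    intro i v a
    have h := hsize i v a
    rw [Data.ofRat, Data.size] at h
    exact ⟨two_mul_le_of_size (by omega), two_mul_le_of_size (by omega)⟩
  have hBE : PolyBound (fun i => q.eval (S i) + 1) fun i : ι => i.1.encode.size :=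
    (PolyBound.trans ⟨q, fun _ => le_rfl⟩ hS).add (.const 1 _)
  have hrun := PolyTime.dpRun (P := fun i : ι => i.1.P) (X := fun i => i.1.x)
    (ρ := fun i v a => r i.1.P i.1.x v a) ver hP hX hρ hTree hT hB hBE
  have hres := PolyTime.dpResult ver hrun hk
  choose c hc w hw hl using fun i : ι =>
    dpResult_spec (ver := ver) (hTree i) (hT i) (hB i) i.2.2.2.2 i.2.2.1 i.2.1
  have hcand : PolyTime (fun i : ι => i.1.encode) fun i => candData (c i) :=
    hres.data_fst.congr fun i => by rw [hc i]; rfl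
  exact (PolyTime.assignment (P := fun i : ι => i.1.P) (PolyTime.voters hP)
    hcand.snd.snd.fst hl).solvable fun i => ⟨w i, hw i, rfl⟩
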